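/- Let $V_{\mathbb R}$ be a real Euclidean space of dimension $\ell$, let $W\subset O(V_{\mathbb R})$ be a nontrivial finite group generated by reflections that acts irreducibly on $V_{\mathbb R}$, and put $V=\mathbb C\otimes V_{\mathbb R}$. Let $S$ be the set of reflections of $W$, let $S/W$ be its set of $W$-conjugacy classes, and for $s\in S$ let $\alpha_s\in V_{\mathbb R}$ be a root of $s$ (a nonzero vector with $s(\alpha_s)=-\alpha_s$). Let $\mathbb R[c]\subset\mathbb C[c]\subset\mathbb C(c)$ be the polynomial rings and the field of rational functions in variables indexed by $S/W$; write $c(s)$ for the variable of the class of $s$, and put $h_c=\frac{2}{\ell}\sum_{s\in S}c(s)$. For $y\in V_{\mathbb R}$ the Dunkl operator on $\mathbb C(c)\otimes S(V)$ is $$\nabla_y=\partial_y-\sum_{s\in S}c(s)\,\frac{\langle y,\alpha_s\rangle}{\alpha_s}(1-s),$$ where $\langle\cdot,\cdot\rangle$ is the scalar product and $\partial_y$ is the $\mathbb C(c)$-linear derivation with $\partial_y(x)=\langle y,x\rangle$ for $x\in V_{\mathbb R}$. These operators commute, so they define $\nabla_f$ for every $f\in\mathbb C(c)\otimes S(V)$,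 linearly in $f$ and with $\nabla_{fg}=\nabla_f\nabla_g$. Put $(f,g)_c=[\nabla_f(g)]_0\in\mathbb C(c)$, where $[\,\cdot\,]_0$ is the constant term. Let $S(V)_+$ and $S(V_{\mathbb R})_+$ consist of the polynomials with zero constant term, and put $$\Phi_c(u,v)=\frac{(u,v)_c}{1-h_c}\in\mathbb C(c)\qquad\text{for } u,v\in\mathbb C[c]\otimes S(V)_+ .$$ Then the following hold. (a) The form $\Phi_c$ takes its values in $\mathbb C[c]$. Consequently there is a unique $\mathbb C[c]/(1-h_c)$-bilinear form $\overline\Phi_c$ on $\mathbb C[c]/(1-h_c)\otimes S(V)_+$, with values in $\mathbb C[c]/(1-h_c)$, such that $\overline\Phi_c(\pi(u),\pi(v))=\pi(\Phi_c(u,v))$ for all $u,v\in\mathbb C[c]\otimes S(V)_+$, where $\pi$ denotes reduction modulo $(1-h_c)$. (b) $\overline\Phi_c(u,u)\neq 0$ for every nonzero $u\in\mathbb R[c]/(1-h_c)\otimes_{\mathbb R}S(V_{\mathbb R})_+$. (c) For every real linear subspace $U_{\mathbb R}\subset S(V_{\mathbb R})_+$ the restriction of $\overline\Phi_c$ to $\mathbb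 C[c]/(1-h_c)\otimes_{\mathbb R}U_{\mathbb R}$ is nondegenerate: no nonzero element is orthogonal, on the left or on the right, to the whole of it. -/

import Mathlib

noncomputable section

namespace Dunkl

open MvPolynomial

variable {E : Type*} [NormedAddCommGroup E] [InnerProductSpace ℝ E]

/-- An orthogonal reflection: it negates some nonzero vector `α` (a root) and fixes the
hyperplane orthogonal to `α`. -/
def IsReflection (s : E ≃ₗᵢ[ℝ] E) : Prop :=
  ∃ α : E, α ≠ 0 ∧ s = (Submodule.span ℝ {α})ᗮ.reflection

/-- The set `S` of all reflections in `W`. -/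
abbrev Refl (W : Subgroup (E ≃ₗᵢ[ℝ] E)) : Type _ :=
  {s : W // IsReflection (s : E ≃ₗᵢ[ℝ] E)}

instance (W : Subgroup (E ≃ₗᵢ[ℝ] E)) [Finite W] : Fintype (Refl W) := Fintype.ofFinite _

/-- A root `α_s` of the reflection `s`. It is determined up to a nonzero scalar, and the Dunkl
operators below do not depend on that scalar. -/
def root {W : Subgroup (E ≃ₗᵢ[ℝ] E)} (s : Refl W) : E := s.2.choose

/-- Conjugacy under `W` of reflections of `W`. -/
instance reflSetoid (W : Subgroup (E ≃ₗᵢ[ℝ] E)) : Setoid (Refl W) :=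
  (IsConj.setoid W).comap Subtype.val

/-- The set `S/W` of `W`-orbits in `S`. -/
abbrev ReflClass (W : Subgroup (E ≃ₗᵢ[ℝ] E)) : Type _ := Quotient (reflSetoid W)

section Operators

variable {ℓ : ℕ} (b : OrthonormalBasis (Fin ℓ) ℝ E)
  (R : Type*) [CommRing R] [Algebra ℝ R]

/-- A vector `v`, as an element of degree one of `R ⊗ S(V)`. The latter is identified with the
polynomial ring in the elements `x_i = b i` of an orthonormal basis. -/
def lin (v : E) : MvPolynomial (Fin ℓ) R :=
  ∑ i, C (algebraMap ℝ R (inner ℝ (b i) v)) * X i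

/-- The action of an isometry on `R ⊗ S(V)` by algebra automorphisms, `x_i ↦ w(x_i)`. -/
def act (w : E ≃ₗᵢ[ℝ] E) : MvPolynomial (Fin ℓ) R →ₐ[R] MvPolynomial (Fin ℓ) R :=
  aeval fun i => lin b R (w (b i))

theorem lin_basis (i : Fin ℓ) : lin b R (b i) = X i := by
  classical
  simp [lin, b.inner_eq_ite, apply_ite (algebraMap ℝ R), apply_ite (C : R → _)]

theorem lin_sub_smul (v w : E) (t : ℝ) :
    lin b R (v - t • w) = lin b R v - C (algebraMap ℝ R t) * lin b R w := by
  simp only [lin, inner_sub_right, inner_smul_right, map_sub, map_mul, sub_mul,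
    Finset.sum_sub_distrib, Finset.mul_sum, mul_assoc]

theorem lin_ne_zero [Nontrivial R] {v : E} (hv : v ≠ 0) : lin b R v ≠ 0 := by
  classical
  intro h
  apply hv
  have key : ∀ i, inner ℝ (b i) v = 0 := fun i => by
    have := congrArg (coeff (Finsupp.single i 1)) h
    simpa [lin, coeff_sum, coeff_C_mul, coeff_X, Finsupp.single_left_inj] using this
  rw [← b.sum_repr' v]
  simp [key]

theorem root_ne_zero {W : Subgroup (E ≃ₗᵢ[ℝ] E)} (s : Refl W) : root s ≠ 0 :=
  s.2.choose_spec.1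

/-- The polynomial `f - s(f)` is divisible by `α_s`. -/
theorem root_dvd {W : Subgroup (E ≃ₗᵢ[ℝ] E)} (s : Refl W) (f : MvPolynomial (Fin ℓ) R) :
    lin b R (root s) ∣ f - act b R (s : W) f := by
  induction f using MvPolynomial.induction_on with
  | C a => simp [act]
  | add p q hp hq =>
    rw [map_add, add_sub_add_comm]
    exact dvd_add hp hq
  | mul_X p i hp =>
    have hX : lin b R (root s) ∣ X i - act b R (s : W) (X i) := by
      have hs : ((s : W) : E ≃ₗᵢ[ℝ] E) (b i) =
          b i - (2 * (inner ℝ (root s) (b i) / ‖root s‖ ^ 2)) • root s := by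
        have h := s.2.choose_spec.2
        change _ = (Submodule.span ℝ {root s})ᗮ.reflection at h
        rw [h, Submodule.reflection_orthogonal_apply, Submodule.reflection_singleton_apply]
        simp [two_mul, two_smul, add_smul, sub_eq_add_neg]
      have : act b R (s : W) (X i) = lin b R (((s : W) : E ≃ₗᵢ[ℝ] E) (b i)) := by simp [act]
      rw [this, hs, lin_sub_smul, lin_basis, sub_sub_cancel]
      exact dvd_mul_left _ _
    have : p * X i - act b R (s : W) (p * X i) =
        (p - act b R (s : W) p) * X i + act b R (s : W) p * (X i - act b R (s : W) (X i)) := by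
      rw [map_mul]; ring
    rw [this]
    exact dvd_add (hp.mul_right _) (hX.mul_left _)

variable [IsDomain R]

/-- The operator `f ↦ (f - s(f)) / α_s`. -/
def divDiff {W : Subgroup (E ≃ₗᵢ[ℝ] E)} (s : Refl W) :
    Module.End R (MvPolynomial (Fin ℓ) R) where
  toFun f := (root_dvd b R s f).choose
  map_add' f g := by
    apply mul_left_cancel₀ (lin_ne_zero b R (root_ne_zero s))
    rw [mul_add, ← (root_dvd b R s (f + g)).choose_spec, ← (root_dvd b R s f).choose_spec,
      ← (root_dvd b R s g).choose_spec, map_add]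
    ring
  map_smul' r f := by
    apply mul_left_cancel₀ (lin_ne_zero b R (root_ne_zero s))
    rw [RingHom.id_apply, mul_smul_comm, ← (root_dvd b R s (r • f)).choose_spec,
      ← (root_dvd b R s f).choose_spec, map_smul, smul_sub]

theorem root_mul_divDiff {W : Subgroup (E ≃ₗᵢ[ℝ] E)} (s : Refl W) (f : MvPolynomial (Fin ℓ) R) :
    lin b R (root s) * divDiff b R s f = f - act b R (s : W) f :=
  (root_dvd b R s f).choose_spec.symm

variable {R} {W : Subgroup (E ≃ₗᵢ[ℝ] E)} [Finite W]

/-- The Dunkl operator `∇_y = ∂_y - ∑_{s ∈ S} c(s) (⟨y, α_s⟩ / α_s) (1 - s)` for a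
`W`-invariant function `c` on `S`. -/
def dunkl (c : ReflClass W → R) (y : E) : Module.End R (MvPolynomial (Fin ℓ) R) :=
  ∑ i, algebraMap ℝ R (inner ℝ (b i) y) • (pderiv (R := R) i).toLinearMap
    - ∑ s : Refl W, (c ⟦s⟧ * algebraMap ℝ R (inner ℝ y (root s))) • divDiff b R s

/-- The operators `∇_p`, where `V` and its dual are identified by the scalar product. They depend
linearly on `p`, and for a monomial `p = x_1^{a_1} ⋯ x_ℓ^{a_ℓ}` one has
`∇_p = ∇_{x_1}^{a_1} ⋯ ∇_{x_ℓ}^{a_ℓ}`. (The Dunkl operators commute, so the order of the factors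
is immaterial; fixing one makes the definition independent of that fact.) -/
def nabla (c : ReflClass W → R) :
    MvPolynomial (Fin ℓ) R →ₗ[R] Module.End R (MvPolynomial (Fin ℓ) R) :=
  (basisMonomials (Fin ℓ) R).constr R
    fun a => (List.ofFn fun i : Fin ℓ => dunkl b c (b i) ^ a i).prod

/-- The bilinear form `(f, g)_c = [∇_f(g)]_0`, where `[·]_0` is the constant term. -/
def form (c : ReflClass W → R) : LinearMap.BilinForm R (MvPolynomial (Fin ℓ) R) :=
  (nabla b c).compr₂ (lcoeff R 0)

end Operators

section Parameters

/-- The linear function `h_c = (2/ℓ) ∑_{s ∈ S} c(s)` of the parameter, where `ℓ = dim V`. -/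
def hc {W : Subgroup (E ≃ₗᵢ[ℝ] E)} [Finite W] {R : Type*} [CommRing R] [Algebra ℝ R]
    (ℓ : ℕ) (c : ReflClass W → R) : R :=
  algebraMap ℝ R (2 / (ℓ : ℝ)) * ∑ s : Refl W, c ⟦s⟧

variable (k : Type*) [Field k] [Algebra ℝ k] (ℓ : ℕ) (W : Subgroup (E ≃ₗᵢ[ℝ] E))

/-- The ring `k[c]` of polynomial functions of the parameter `c`. -/
abbrev ParamRing : Type _ := MvPolynomial (ReflClass W) k

variable [Finite W]

/-- The ideal `(1 - h_c)` of `k[c]`. -/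
def hcIdeal : Ideal (ParamRing k W) :=
  Ideal.span {1 - hc ℓ (X : ReflClass W → ParamRing k W)}

/-- The ring `k[c]/(1 - h_c)`. -/
abbrev QuotRing : Type _ := ParamRing k W ⧸ hcIdeal k ℓ W

theorem hcIdeal_le_comap :
    hcIdeal ℝ ℓ W ≤ (hcIdeal ℂ ℓ W).comap (MvPolynomial.map (algebraMap ℝ ℂ)) := by
  rw [hcIdeal, Ideal.span_singleton_le_iff_mem, Ideal.mem_comap]
  have : MvPolynomial.map (algebraMap ℝ ℂ) (1 - hc ℓ (X : ReflClass W → ParamRing ℝ W)) =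
      1 - hc ℓ (X : ReflClass W → ParamRing ℂ W) := by
    simp [hc, MvPolynomial.algebraMap_eq, MvPolynomial.algebraMap_apply]
  rw [this]
  exact Ideal.mem_span_singleton_self _

/-- The canonical map `ℝ[c]/(1 - h_c) → ℂ[c]/(1 - h_c)`. -/
def quotComplexify : QuotRing ℝ ℓ W →+* QuotRing ℂ ℓ W :=
  Ideal.quotientMap _ (MvPolynomial.map (algebraMap ℝ ℂ)) (hcIdeal_le_comap ℓ W)

end Parameters

section PositiveDegree

variable (ℓ : ℕ)

/-- `R ⊗ S(V)_+`: the polynomials with zero constant term. -/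
def SPlus (R : Type*) [CommRing R] : Submodule R (MvPolynomial (Fin ℓ) R) :=
  LinearMap.ker (lcoeff R 0)

variable {ℓ}

/-- Change of coefficients on polynomials with zero constant term. -/
def SPlus.map {R R' : Type*} [CommRing R] [CommRing R'] (φ : R →+* R') (f : SPlus ℓ R) :
    SPlus ℓ R' :=
  ⟨MvPolynomial.map φ f, by
    have h := f.2
    simp only [SPlus, LinearMap.mem_ker, lcoeff_apply] at h ⊢
    rw [coeff_map, h, map_zero]⟩

variable (b : OrthonormalBasis (Fin ℓ) ℝ E) (W : Subgroup (E ≃ₗᵢ[ℝ] E)) [Finite W]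

/-- The form `(·,·)_c` for the generic parameter `c`, with values in the field `ℂ(c)`. -/
def genericForm : LinearMap.BilinForm (FractionRing (ParamRing ℂ W))
    (MvPolynomial (Fin ℓ) (FractionRing (ParamRing ℂ W))) :=
  form b fun o => algebraMap (ParamRing ℂ W) (FractionRing (ParamRing ℂ W)) (X o)

/-- The rescaled form `Φ_c(f, g) = (f, g)_c / (1 - h_c)` on `ℂ[c] ⊗ S(V)_+`, with values
in `ℂ(c)`. -/
def Phi (f g : SPlus ℓ (ParamRing ℂ W)) : FractionRing (ParamRing ℂ W) :=
  genericForm b W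
      (MvPolynomial.map (algebraMap (ParamRing ℂ W) (FractionRing (ParamRing ℂ W))) f)
      (MvPolynomial.map (algebraMap (ParamRing ℂ W) (FractionRing (ParamRing ℂ W))) g) /
    algebraMap (ParamRing ℂ W) (FractionRing (ParamRing ℂ W))
      (1 - hc ℓ (X : ReflClass W → ParamRing ℂ W))

/-- `Ψ` is the reduction of `Φ_c` modulo `(1 - h_c)`:
`Ψ(π(f), π(g)) = π(Φ_c(f, g))` for all `f`, `g` in `ℂ[c] ⊗ S(V)_+`, where `π` is reduction modulo
`(1 - h_c)`. As `π` is surjective, there is at most one such form if `Φ_c` takes its values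
in `ℂ[c]`. -/
def IsReductionOfPhi
    (Ψ : LinearMap.BilinForm (QuotRing ℂ ℓ W) (SPlus ℓ (QuotRing ℂ ℓ W))) : Prop :=
  ∀ (f g : SPlus ℓ (ParamRing ℂ W)) (p : ParamRing ℂ W),
    algebraMap (ParamRing ℂ W) (FractionRing (ParamRing ℂ W)) p = Phi b W f g →
      Ψ (SPlus.map (Ideal.Quotient.mk (hcIdeal ℂ ℓ W)) f)
        (SPlus.map (Ideal.Quotient.mk (hcIdeal ℂ ℓ W)) g) =
      Ideal.Quotient.mk (hcIdeal ℂ ℓ W) p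

/-- `ℂ[c]/(1 - h_c) ⊗ U` for a real subspace `U` of `S(V_ℝ)_+`, inside
`ℂ[c]/(1 - h_c) ⊗ S(V)_+`. -/
def extendScalars (U : Submodule ℝ (SPlus ℓ ℝ)) :
    Submodule (QuotRing ℂ ℓ W) (SPlus ℓ (QuotRing ℂ ℓ W)) :=
  Submodule.span (QuotRing ℂ ℓ W) (SPlus.map (algebraMap ℝ (QuotRing ℂ ℓ W)) '' U)

end PositiveDegree

end Dunkl

end

/-! The divisibility by $1-h_c$ comes from Schur's lemma. By irreducibility, $\sum_s c(s)(1-s)$ acts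
on the reflection representation as the scalar $h_c$ (`sum_reflCoeff`), hence $[\nabla_y
f]_0=(1-h_c)[\partial_y f]_0$ (`constantCoeff_dunkl`). Replacing the last Dunkl operator in
$[\nabla_f g]_0$ by a derivative therefore defines a form `phi` over any coefficient domain. It
represents $\Phi_c$ for generic $c$ and still makes sense where $h_c=1$.

Nonvanishing comes from positivity: if $c$ is real, $c>0$ and $h_c=1$, then `phi` is positive
definite on $S(V_{\mathbb R})_+$ (`phi_pos`). Distinct degrees are orthogonal, and in degree one
`phi` is the scalar product. In higher degree the operator $B=\sum x_i\nabla_{x_i}$ satisfies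
$\Phi(Bf,f)=\sum_i\Phi(\nabla_{x_i}f,\nabla_{x_i}f)$, which the induction hypothesis controls. In a
fixed degree, $B$ is a scalar minus $\sum c(s)(1-s)$, hence self-adjoint both for $\Phi$ and for the
Fischer form, the form with $c=0$. If $B$ is positive for the Fischer form, it has a positive square
root, and positivity of $\Phi(Bf,f)$ passes to $\Phi(f,f)$ (`pos_of_symmetric_pair`).

For the positivity of $B$, the condition $h_c=1$ lets the Euler field be written as $\sum
c(s)\,2u_s\partial_{u_s}$ with unit roots $u_s$, so $B=\sum c(s)\,(2u_s\partial_{u_s}-(1-s))$.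
Splitting $f$ into parts even and odd under $s$ shows that each summand is nonnegative, and that it
vanishes on $f$ only if $\partial_{u_s}^2f=0$ (`form_zero_reflEuler`). If this holds for all $s$,
irreducibility kills the whole Hessian (`bilin_eq_zero_of_root_self`), so $f=0$ in degree at least
two.

Finally, a polynomial in $c$ outside $(1-h_c)$ is nonzero at some positive real point of $h_c=1$
(`exists_pos_eval_ne_zero`). Evaluating there, a nonzero $u$ pairs nontrivially with its complex
conjugate (`mk_phi_conj_ne_zero`). Real elements are their own conjugates, which gives (b); scalar
extensions of real subspaces are stable under conjugation, which gives (c). -/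

noncomputable section

namespace Dunkl

open MvPolynomial

variable {E : Type*} [NormedAddCommGroup E] [InnerProductSpace ℝ E]

/-! ### Reflections, their matrix coefficients, and conjugation by $W$ -/

section Reflections

variable {W : Subgroup (E ≃ₗᵢ[ℝ] E)}

/-- The matrix coefficient `⟨y, x - s x⟩` of a reflection. -/
def reflCoeff (s : Refl W) (y x : E) : ℝ :=
  inner ℝ y (x - ((s : W) : E ≃ₗᵢ[ℝ] E) x)

theorem refl_apply (s : Refl W) (v : E) :
    ((s : W) : E ≃ₗᵢ[ℝ] E) v =
      v - (2 * (inner ℝ (root s) v / ‖root s‖ ^ 2)) • root s := by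
  have h := s.2.choose_spec.2
  change _ = (Submodule.span ℝ {root s})ᗮ.reflection at h
  rw [h, Submodule.reflection_orthogonal_apply, Submodule.reflection_singleton_apply]
  simp [two_mul, two_smul, add_smul, sub_eq_add_neg]

theorem sub_refl_apply (s : Refl W) (v : E) :
    v - ((s : W) : E ≃ₗᵢ[ℝ] E) v =
      (2 * (inner ℝ (root s) v / ‖root s‖ ^ 2)) • root s := by
  rw [refl_apply, sub_sub_cancel]

theorem norm_root_sq_ne_zero (s : Refl W) : ‖root s‖ ^ 2 ≠ 0 :=
  pow_ne_zero _ (norm_ne_zero_iff.2 (root_ne_zero s))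

theorem refl_refl (s : Refl W) (v : E) :
    ((s : W) : E ≃ₗᵢ[ℝ] E) (((s : W) : E ≃ₗᵢ[ℝ] E) v) = v := by
  have h := s.2.choose_spec.2
  rw [h]
  exact Submodule.reflection_reflection _ _

theorem refl_mul_self (s : Refl W) : (s : W) * (s : W) = 1 := by
  ext v
  exact refl_refl s v

theorem reflCoeff_eq (s : Refl W) (y x : E) :
    reflCoeff s y x = 2 * (inner ℝ (root s) x / ‖root s‖ ^ 2) * inner ℝ y (root s) := by
  rw [reflCoeff, sub_refl_apply, inner_smul_right]

theorem reflCoeff_comm (s : Refl W) (y x : E) : reflCoeff s y x = reflCoeff s x y := by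
  rw [reflCoeff_eq, reflCoeff_eq, real_inner_comm y, real_inner_comm x]
  ring

/-- The operator $1-s$ has rank one. This is the only fact about individual reflections needed for
the commutativity of the Dunkl operators. -/
theorem reflCoeff_smul_sub (s : Refl W) (y z x : E) :
    reflCoeff s y x • (z - ((s : W) : E ≃ₗᵢ[ℝ] E) z) =
      reflCoeff s z x • (y - ((s : W) : E ≃ₗᵢ[ℝ] E) y) := by
  rw [sub_refl_apply, sub_refl_apply, smul_smul, smul_smul, reflCoeff_eq, reflCoeff_eq,
    real_inner_comm y, real_inner_comm z]
  congr 1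
  ring

theorem IsReflection.conj {s : E ≃ₗᵢ[ℝ] E} (hs : IsReflection s) (w : E ≃ₗᵢ[ℝ] E) :
    IsReflection (w * s * w⁻¹) := by
  obtain ⟨α, h0, rfl⟩ := hs
  refine ⟨w α, by simpa using h0, ?_⟩
  ext v
  have hw : w (w⁻¹ v) = v := w.apply_symm_apply v
  have h1 : inner ℝ (w α) v = inner ℝ α (w⁻¹ v) := by
    rw [← w.inner_map_map α, hw]
  simp only [LinearIsometryEquiv.coe_mul, Function.comp_apply,
    Submodule.reflection_orthogonal_apply, Submodule.reflection_singleton_apply, map_neg, map_sub,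
    map_nsmul, map_smul, hw, h1, LinearIsometryEquiv.norm_map]

/-- Conjugation by an element of `W` permutes the reflections. -/
def conjRefl (w : W) : Refl W ≃ Refl W where
  toFun s := ⟨w * s * w⁻¹, s.2.conj _⟩
  invFun s := ⟨w⁻¹ * s * w, by simpa using s.2.conj ((w⁻¹ : W) : E ≃ₗᵢ[ℝ] E)⟩
  left_inv s := by ext1; simp [mul_assoc]
  right_inv s := by ext1; simp [mul_assoc]

theorem mk_conjRefl (w : W) (s : Refl W) : (⟦conjRefl w s⟧ : ReflClass W) = ⟦s⟧ := by
  refine Quotient.sound ?_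
  change IsConj (w * s * w⁻¹ : W) s
  exact (isConj_iff.2 ⟨w, rfl⟩).symm

theorem coe_conjRefl_mul (w : W) (s : Refl W) : ((conjRefl w s : Refl W) : W) * w = w * s := by
  simp [conjRefl]

theorem reflCoeff_conjRefl (w : W) (s : Refl W) (y x : E) :
    reflCoeff (conjRefl w s) ((w : E ≃ₗᵢ[ℝ] E) y) ((w : E ≃ₗᵢ[ℝ] E) x) = reflCoeff s y x := by
  have h : (((conjRefl w s : Refl W) : W) : E ≃ₗᵢ[ℝ] E) ((w : E ≃ₗᵢ[ℝ] E) x) =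
      (w : E ≃ₗᵢ[ℝ] E) (((s : W) : E ≃ₗᵢ[ℝ] E) x) :=
    congrArg (fun g : W => (g : E ≃ₗᵢ[ℝ] E) x) (coe_conjRefl_mul w s)
  rw [reflCoeff, h, ← map_sub, LinearIsometryEquiv.inner_map_map, reflCoeff]

end Reflections

/-! ### Derivatives, divided differences, and commutativity of the Dunkl operators -/

section Operators

variable {ℓ : ℕ} (b : OrthonormalBasis (Fin ℓ) ℝ E) (R : Type*) [CommRing R] [Algebra ℝ R]

theorem lin_sub (v w : E) : lin b R (v - w) = lin b R v - lin b R w := by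
  simpa using lin_sub_smul b R v w 1

theorem lin_zero : lin b R (0 : E) = 0 := by simpa using lin_sub b R 0 0

theorem lin_smul (t : ℝ) (v : E) : lin b R (t • v) = C (algebraMap ℝ R t) * lin b R v := by
  have := lin_sub_smul b R 0 v (-t)
  simpa [lin_zero] using this

theorem lin_add (v w : E) : lin b R (v + w) = lin b R v + lin b R w := by
  simpa using lin_sub_smul b R v w (-1)

theorem lin_sum {ι : Type*} (s : Finset ι) (v : ι → E) :
    lin b R (∑ i ∈ s, v i) = ∑ i ∈ s, lin b R (v i) :=
  map_sum (AddMonoidHom.mk' (lin b R) (lin_add b R)) v s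

theorem isHomogeneous_lin (v : E) : (lin b R v).IsHomogeneous 1 :=
  IsHomogeneous.sum _ _ _ fun _ _ => isHomogeneous_C_mul_X _ _

variable {R}

theorem act_lin (w : E ≃ₗᵢ[ℝ] E) (v : E) : act b R w (lin b R v) = lin b R (w v) := by
  conv_rhs => rw [← b.sum_repr' v]
  rw [map_sum, lin_sum, lin, map_sum]
  refine Finset.sum_congr rfl fun i _ => ?_
  rw [map_smul, lin_smul, map_mul]
  simp [act]

theorem act_X (w : E ≃ₗᵢ[ℝ] E) (i : Fin ℓ) : act b R w (X i) = lin b R (w (b i)) := by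
  simp [act]

theorem act_mul (w w' : E ≃ₗᵢ[ℝ] E) (f : MvPolynomial (Fin ℓ) R) :
    act b R (w * w') f = act b R w (act b R w' f) := by
  have : act b R (w * w') = (act b R w).comp (act b R w') := by
    ext i
    simp [act_X, act_lin]
  rw [this, AlgHom.comp_apply]

theorem act_one (f : MvPolynomial (Fin ℓ) R) : act b R 1 f = f := by
  have : act b R (1 : E ≃ₗᵢ[ℝ] E) = AlgHom.id R _ := by
    ext i
    simp [act_X, lin_basis]
  rw [this, AlgHom.id_apply]

theorem act_C (w : E ≃ₗᵢ[ℝ] E) (r : R) : act b R w (C r) = C r := by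
  simp [act]

theorem _root_.MvPolynomial.IsHomogeneous.act {f : MvPolynomial (Fin ℓ) R} {n : ℕ}
    (hf : f.IsHomogeneous n) (w : E ≃ₗᵢ[ℝ] E) : (act b R w f).IsHomogeneous n := by
  have := hf.aeval (fun i => lin b R (w (b i))) (fun i => isHomogeneous_lin b R _)
  rwa [one_mul] at this

theorem constantCoeff_lin (v : E) : constantCoeff (lin b R v) = 0 := by
  simp [lin]

theorem constantCoeff_act (w : E ≃ₗᵢ[ℝ] E) (f : MvPolynomial (Fin ℓ) R) :
    constantCoeff (act b R w f) = constantCoeff f := by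
  induction f using MvPolynomial.induction_on with
  | C a => simp
  | add p q hp hq => simp [hp, hq]
  | mul_X p i hp => simp [act_X, constantCoeff_lin]

/-- The derivation `∂_y`. -/
def dirDeriv (y : E) : Derivation R (MvPolynomial (Fin ℓ) R) (MvPolynomial (Fin ℓ) R) :=
  ∑ i, algebraMap ℝ R (inner ℝ (b i) y) • pderiv i

theorem dirDeriv_apply (y : E) (f : MvPolynomial (Fin ℓ) R) :
    dirDeriv b y f = ∑ i, algebraMap ℝ R (inner ℝ (b i) y) • pderiv i f := by
  rw [dirDeriv, ← Derivation.coeFnAddMonoidHom_apply, map_sum, Finset.sum_apply]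
  rfl

theorem dirDeriv_lin (y x : E) :
    dirDeriv b y (lin b R x) = C (algebraMap ℝ R (inner ℝ y x)) := by
  classical
  rw [dirDeriv_apply]
  have h : ∀ i, pderiv i (lin b R x) = C (algebraMap ℝ R (inner ℝ (b i) x)) := by
    intro i
    simp [lin, pderiv_X, Pi.single_apply]
  simp only [h, smul_eq_C_mul, ← map_mul, ← map_sum]
  rw [← b.sum_inner_mul_inner y x]
  simp only [real_inner_comm]

theorem dirDeriv_lin_mul (y x : E) (f : MvPolynomial (Fin ℓ) R) :
    dirDeriv b y (lin b R x * f) =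
      lin b R x * dirDeriv b y f + C (algebraMap ℝ R (inner ℝ y x)) * f := by
  rw [Derivation.leibniz, dirDeriv_lin, smul_eq_mul, smul_eq_mul, mul_comm f]

theorem dirDeriv_sub (y z : E) (f : MvPolynomial (Fin ℓ) R) :
    dirDeriv b (y - z) f = dirDeriv b y f - dirDeriv b z f := by
  simp [dirDeriv_apply, inner_sub_right, sub_smul]

theorem dirDeriv_smul (t : ℝ) (y : E) (f : MvPolynomial (Fin ℓ) R) :
    dirDeriv b (t • y) f = algebraMap ℝ R t • dirDeriv b y f := by
  simp only [dirDeriv_apply, inner_smul_right, Finset.smul_sum, smul_smul, map_mul]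

/-- A polynomial is built from constants by addition and multiplication by vectors. -/
theorem lin_induction {P : MvPolynomial (Fin ℓ) R → Prop} (hC : ∀ r, P (C r))
    (hadd : ∀ f g, P f → P g → P (f + g)) (hlin : ∀ x f, P f → P (lin b R x * f))
    (f : MvPolynomial (Fin ℓ) R) : P f := by
  induction f using MvPolynomial.induction_on with
  | C a => exact hC a
  | add p q hp hq => exact hadd p q hp hq
  | mul_X p i hp =>
    rw [mul_comm, ← lin_basis b R i]
    exact hlin _ _ hp

theorem dirDeriv_act (w : E ≃ₗᵢ[ℝ] E) (y : E) (f : MvPolynomial (Fin ℓ) R) :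
    dirDeriv b (w y) (act b R w f) = act b R w (dirDeriv b y f) := by
  refine lin_induction b (P := fun f => dirDeriv b (w y) (act b R w f) =
    act b R w (dirDeriv b y f)) (fun r => ?_) (fun f g hf hg => ?_) (fun x f hf => ?_) f
  · rw [act_C, ← algebraMap_eq, Derivation.map_algebraMap, Derivation.map_algebraMap, map_zero]
  · simp only [map_add, hf, hg]
  · rw [map_mul, act_lin, dirDeriv_lin_mul, dirDeriv_lin_mul, hf, map_add, map_mul, map_mul,
      act_lin, act_C, LinearIsometryEquiv.inner_map_map]

theorem dirDeriv_basis (i : Fin ℓ) (f : MvPolynomial (Fin ℓ) R) :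
    dirDeriv b (b i) f = pderiv i f := by
  classical
  simp [dirDeriv_apply, b.inner_eq_ite, apply_ite (algebraMap ℝ R)]

theorem monomial_add_single_eq (a : Fin ℓ →₀ ℕ) (i : Fin ℓ) :
    monomial (a + Finsupp.single i 1) (1 : R) = lin b R (b i) * monomial a 1 := by
  rw [lin_basis, X, monomial_mul, one_mul, add_comm]

section

variable {R' : Type*} [CommRing R'] [Algebra ℝ R'] (φ : R →ₐ[ℝ] R')

theorem map_lin (v : E) : map (φ : R →+* R') (lin b R v) = lin b R' v := by
  simp [lin]

theorem map_act (w : E ≃ₗᵢ[ℝ] E) (f : MvPolynomial (Fin ℓ) R) :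
    map (φ : R →+* R') (act b R w f) = act b R' w (map (φ : R →+* R') f) := by
  induction f using MvPolynomial.induction_on with
  | C a => simp
  | add p q hp hq => simp only [map_add, hp, hq]
  | mul_X p i hp => simp only [map_mul, hp, act_X, map_X, map_lin]

end

variable {W : Subgroup (E ≃ₗᵢ[ℝ] E)}

theorem act_act_refl (s : Refl W) (f : MvPolynomial (Fin ℓ) R) :
    act b R (s : W) (act b R (s : W) f) = f := by
  rw [← act_mul]
  have : ((s : W) : E ≃ₗᵢ[ℝ] E) * ((s : W) : E ≃ₗᵢ[ℝ] E) = 1 :=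
    congrArg Subtype.val (refl_mul_self s)
  rw [this, act_one]

variable [IsDomain R]

/-- A twisted Leibniz rule, checked after multiplication by the root. -/
theorem divDiff_lin_mul (s : Refl W) (x : E) (f : MvPolynomial (Fin ℓ) R) :
    divDiff b R s (lin b R x * f) = lin b R x * divDiff b R s f +
      C (algebraMap ℝ R (2 * (inner ℝ (root s) x / ‖root s‖ ^ 2))) * act b R (s : W) f := by
  apply mul_left_cancel₀ (lin_ne_zero b R (root_ne_zero s))
  have h : lin b R (((s : W) : E ≃ₗᵢ[ℝ] E) x) = lin b R x -
      C (algebraMap ℝ R (2 * (inner ℝ (root s) x / ‖root s‖ ^ 2))) * lin b R (root s) := by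
    rw [refl_apply, lin_sub_smul]
  rw [root_mul_divDiff, map_mul, act_lin, h, mul_add, mul_left_comm, root_mul_divDiff]
  ring

theorem divDiff_C (s : Refl W) (r : R) : divDiff b R s (C r) = 0 := by
  apply mul_left_cancel₀ (lin_ne_zero b R (root_ne_zero s))
  rw [root_mul_divDiff, act_C, sub_self, mul_zero]

variable [Finite W]

theorem dunkl_apply (c : ReflClass W → R) (y : E) (f : MvPolynomial (Fin ℓ) R) :
    dunkl b c y f = dirDeriv b y f -
      ∑ s : Refl W, (c ⟦s⟧ * algebraMap ℝ R (inner ℝ y (root s))) • divDiff b R s f := by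
  simp [dunkl, dirDeriv_apply, LinearMap.sub_apply, LinearMap.sum_apply]

theorem dunkl_zero_param (y : E) (f : MvPolynomial (Fin ℓ) R) :
    dunkl b (0 : ReflClass W → R) y f = dirDeriv b y f := by
  simp [dunkl_apply]

theorem dunkl_sub (c : ReflClass W → R) (y z : E) (f : MvPolynomial (Fin ℓ) R) :
    dunkl b c (y - z) f = dunkl b c y f - dunkl b c z f := by
  simp only [dunkl_apply, dirDeriv_sub, inner_sub_left, map_sub, mul_sub, sub_smul,
    Finset.sum_sub_distrib]
  abel

theorem dunkl_smul (c : ReflClass W → R) (t : ℝ) (y : E) (f : MvPolynomial (Fin ℓ) R) :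
    dunkl b c (t • y) f = algebraMap ℝ R t • dunkl b c y f := by
  simp only [dunkl_apply, dirDeriv_smul, real_inner_smul_left, map_mul, smul_sub,
    Finset.smul_sum, smul_smul, mul_left_comm]

theorem dunkl_C (c : ReflClass W → R) (y : E) (r : R) : dunkl b c y (C r) = 0 := by
  simp [dunkl_apply, divDiff_C]

/-- The commutation relation of a Dunkl operator with multiplication by a vector. Together with the
vanishing on constants it determines the operator, so later properties follow by `lin_induction`
without returning to the division by roots. -/
theorem dunkl_lin_mul (c : ReflClass W → R) (y x : E) (f : MvPolynomial (Fin ℓ) R) :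
    dunkl b c y (lin b R x * f) = lin b R x * dunkl b c y f +
      C (algebraMap ℝ R (inner ℝ y x)) * f -
      ∑ s : Refl W, (c ⟦s⟧ * algebraMap ℝ R (reflCoeff s y x)) • act b R (s : W) f := by
  simp only [dunkl_apply, dirDeriv_lin_mul, divDiff_lin_mul, smul_add, Finset.sum_add_distrib,
    mul_sub, Finset.mul_sum, mul_smul_comm]
  have : ∀ s : Refl W, (c ⟦s⟧ * algebraMap ℝ R (inner ℝ y (root s))) •
      (C (algebraMap ℝ R (2 * (inner ℝ (root s) x / ‖root s‖ ^ 2))) * act b R (s : W) f) =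
      (c ⟦s⟧ * algebraMap ℝ R (reflCoeff s y x)) • act b R (s : W) f := by
    intro s
    rw [← smul_eq_C_mul, smul_smul, mul_assoc, ← map_mul, reflCoeff_eq, mul_comm (inner ℝ y _)]
  simp only [this]
  abel

theorem dunkl_act (c : ReflClass W → R) (w : W) (y : E) (f : MvPolynomial (Fin ℓ) R) :
    dunkl b c ((w : E ≃ₗᵢ[ℝ] E) y) (act b R w f) = act b R w (dunkl b c y f) := by
  refine lin_induction b (P := fun f => dunkl b c ((w : E ≃ₗᵢ[ℝ] E) y) (act b R w f) =
    act b R w (dunkl b c y f)) (fun r => ?_)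
    (fun f g hf hg => ?_) (fun x f hf => ?_) f
  · rw [act_C, dunkl_C, dunkl_C, map_zero]
  · simp only [map_add, hf, hg]
  · rw [map_mul, act_lin, dunkl_lin_mul, dunkl_lin_mul, hf, map_sub, map_add, map_mul, map_mul,
      act_lin, act_C, LinearIsometryEquiv.inner_map_map, map_sum,
      ← (conjRefl w).sum_comp]
    refine congrArg₂ _ rfl (Finset.sum_congr rfl fun s _ => ?_)
    have h : (((conjRefl w s : Refl W) : W) : E ≃ₗᵢ[ℝ] E) * (w : E ≃ₗᵢ[ℝ] E) =
        (w : E ≃ₗᵢ[ℝ] E) * ((s : W) : E ≃ₗᵢ[ℝ] E) :=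
      congrArg Subtype.val (coe_conjRefl_mul w s)
    rw [mk_conjRefl, reflCoeff_conjRefl, map_smul, ← act_mul, ← act_mul, h]

theorem dunkl_act_refl (c : ReflClass W → R) (s : Refl W) (y : E) (f : MvPolynomial (Fin ℓ) R) :
    dunkl b c y (act b R (s : W) f) =
      act b R (s : W) (dunkl b c (((s : W) : E ≃ₗᵢ[ℝ] E) y) f) := by
  rw [← dunkl_act, refl_refl]

/-- The commutator of two Dunkl operators kills constants and commutes with multiplication by
vectors. In the latter claim the derivative terms cancel at once, and the reflection terms cancel
for each $s$ separately. -/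
theorem dunkl_comm (c : ReflClass W → R) (y z : E) (f : MvPolynomial (Fin ℓ) R) :
    dunkl b c y (dunkl b c z f) = dunkl b c z (dunkl b c y f) := by
  refine lin_induction b (P := fun f => dunkl b c y (dunkl b c z f) =
    dunkl b c z (dunkl b c y f)) (fun r => ?_)
    (fun f g hf hg => ?_) (fun x f hf => ?_) f
  · simp only [dunkl_C, map_zero]
  · simp only [map_add, hf, hg]
  · have key : ∀ s : Refl W,
        (c ⟦s⟧ * algebraMap ℝ R (reflCoeff s z x)) • dunkl b c y (act b R (s : W) f) +
        (c ⟦s⟧ * algebraMap ℝ R (reflCoeff s y x)) • act b R (s : W) (dunkl b c z f) =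
        (c ⟦s⟧ * algebraMap ℝ R (reflCoeff s y x)) • dunkl b c z (act b R (s : W) f) +
        (c ⟦s⟧ * algebraMap ℝ R (reflCoeff s z x)) • act b R (s : W) (dunkl b c y f) := by
      intro s
      -- The rank-one identity, transported through the linear dependence of the Dunkl operator on
      -- its direction.
      have h := congrArg (fun v => c ⟦s⟧ • act b R (s : W) (dunkl b c v f))
        (reflCoeff_smul_sub s y z x)
      simp only [dunkl_smul, dunkl_sub, map_smul, map_sub, smul_sub, smul_smul] at h
      rw [dunkl_act_refl, dunkl_act_refl]
      linear_combination (exp := 1) h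
    have hsum := Finset.sum_congr (rfl : (Finset.univ : Finset (Refl W)) = Finset.univ)
      fun s _ => key s
    simp only [Finset.sum_add_distrib] at hsum
    simp only [dunkl_lin_mul, map_sub, map_add, map_sum, map_smul, ← smul_eq_C_mul, hf]
    linear_combination (exp := 1) -hsum

end Operators

/-! ### Monomials and ordered products of commuting operators -/

theorem monomial_induction {σ R : Type*} [CommRing R] {P : MvPolynomial σ R → Prop}
    (hmon : ∀ a, P (monomial a 1)) (hsmul : ∀ (r : R) f, P f → P (r • f))
    (hadd : ∀ f g, P f → P g → P (f + g)) (f : MvPolynomial σ R) : P f := by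
  induction f using MvPolynomial.induction_on' with
  | monomial a r =>
    have := hsmul r _ (hmon a)
    rwa [smul_monomial, smul_eq_mul, mul_one] at this
  | add p q hp hq => exact hadd p q hp hq

theorem linearMap_ext_monomial {σ R M : Type*} [CommRing R] [AddCommGroup M] [Module R M]
    {S T : MvPolynomial σ R →ₗ[R] M} (h : ∀ a, S (monomial a 1) = T (monomial a 1)) :
    S = T :=
  (basisMonomials σ R).ext fun a => by simpa using h a

theorem prod_ofFn_pow_add_single {M : Type*} [Monoid M] {n : ℕ} (D : Fin n → M)
    (hD : ∀ i j, Commute (D i) (D j)) (a : Fin n → ℕ) (i : Fin n) :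
    (List.ofFn fun j => D j ^ (a j + if i = j then 1 else 0)).prod =
      D i * (List.ofFn fun j => D j ^ a j).prod := by
  induction n with
  | zero => exact i.elim0
  | succ n ih =>
    rw [List.ofFn_succ, List.prod_cons, List.ofFn_succ, List.prod_cons]
    refine Fin.cases ?_ (fun j => ?_) i
    · simp only [if_true, (Fin.succ_ne_zero _).symm, if_false, add_zero, pow_succ', mul_assoc]
    · have := ih (fun k => D k.succ) (fun k l => hD _ _) (fun k => a k.succ) j
      simp only [Fin.succ_ne_zero, if_false, add_zero, Fin.succ_inj, this]
      rw [← mul_assoc, ← mul_assoc, ((hD 0 j.succ).pow_left _).eq]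

/-! ### Schur's lemma for $\sum_s c(s)(1-s)$ -/

section Scalar

variable {W : Subgroup (E ≃ₗᵢ[ℝ] E)} {ℓ : ℕ}

theorem sum_reflCoeff_self (b : OrthonormalBasis (Fin ℓ) ℝ E) (s : Refl W) : ∑ i, reflCoeff s (b i) (b i) = 2 := by
  have h : ∀ i, reflCoeff s (b i) (b i) =
      2 / ‖root s‖ ^ 2 * (inner ℝ (root s) (b i) * inner ℝ (b i) (root s)) := by
    intro i
    rw [reflCoeff_eq]
    ring
  simp only [h, ← Finset.mul_sum, b.sum_inner_mul_inner, real_inner_self_eq_norm_sq]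
  exact div_mul_cancel₀ _ (norm_root_sq_ne_zero s)

variable [Finite W]

/-- The operator `∑_s c(s) (1 - s)` on the reflection representation. -/
def reflSum (c : ReflClass W → ℝ) : E →ₗ[ℝ] E :=
  ∑ s : Refl W, c ⟦s⟧ • (LinearMap.id - ((s : W) : E ≃ₗᵢ[ℝ] E).toLinearEquiv.toLinearMap)

theorem inner_reflSum (c : ReflClass W → ℝ) (y x : E) :
    inner ℝ y (reflSum c x) = ∑ s : Refl W, c ⟦s⟧ * reflCoeff s y x := by
  simp [reflSum, inner_sum, inner_smul_right, reflCoeff]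

theorem reflSum_isSymmetric (c : ReflClass W → ℝ) : (reflSum c).IsSymmetric := by
  intro x y
  rw [real_inner_comm, inner_reflSum, inner_reflSum]
  simp only [reflCoeff_comm _ x]

theorem reflSum_map (c : ReflClass W → ℝ) (w : W) (x : E) :
    reflSum c ((w : E ≃ₗᵢ[ℝ] E) x) = (w : E ≃ₗᵢ[ℝ] E) (reflSum c x) := by
  refine ext_inner_left ℝ fun v => ?_
  obtain ⟨y, rfl⟩ := (w : E ≃ₗᵢ[ℝ] E).surjective v
  rw [LinearIsometryEquiv.inner_map_map, inner_reflSum, inner_reflSum, ← (conjRefl w).sum_comp]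
  simp only [mk_conjRefl, reflCoeff_conjRefl]

/-- For real $c$ the operator `reflSum c` is symmetric, so it has a real eigenvalue. The eigenspace
is $W$-stable, hence everything, and the trace identifies the eigenvalue, each $1-s$ having trace 2.
-/
theorem sum_reflCoeff_real (b : OrthonormalBasis (Fin ℓ) ℝ E)
    (hirred : ∀ U : Submodule ℝ E, (∀ w ∈ W, ∀ x ∈ U, w x ∈ U) → U = ⊥ ∨ U = ⊤)
    (c : ReflClass W → ℝ) (y x : E) :
    ∑ s : Refl W, c ⟦s⟧ * reflCoeff s y x = 2 / ℓ * (∑ s : Refl W, c ⟦s⟧) * inner ℝ y x := by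
  have : FiniteDimensional ℝ E := b.toBasis.finiteDimensional_of_finite
  rcases subsingleton_or_nontrivial E with hE | hE
  · rw [Subsingleton.elim x 0]
    simp [reflCoeff]
  obtain ⟨μ, hμ⟩ : ∃ μ, Module.End.HasEigenvalue (reflSum c) μ :=
    ⟨_, (reflSum_isSymmetric c).hasEigenvalue_iSup_of_finiteDimensional⟩
  have htop : Module.End.eigenspace (reflSum c) μ = ⊤ := by
    refine (hirred _ fun w hw x hx => ?_).resolve_left hμ
    rw [Module.End.mem_eigenspace_iff] at hx ⊢
    rw [reflSum_map c ⟨w, hw⟩, hx, map_smul]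
  have happ : ∀ v, reflSum c v = μ • v := fun v =>
    Module.End.mem_eigenspace_iff.1 (htop ▸ Submodule.mem_top)
  have hinner : ∀ y x, ∑ s : Refl W, c ⟦s⟧ * reflCoeff s y x = μ * inner ℝ y x := by
    intro y x
    rw [← inner_reflSum, happ, inner_smul_right]
  have hℓ : (ℓ : ℝ) ≠ 0 := by
    rintro h
    rw [Nat.cast_eq_zero] at h
    subst h
    exact not_subsingleton E b.toBasis.repr.toEquiv.subsingleton
  have htr : (∑ s : Refl W, c ⟦s⟧) * 2 = μ * ℓ := by
    rw [Finset.sum_mul]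
    calc ∑ s : Refl W, c ⟦s⟧ * 2 = ∑ i, ∑ s : Refl W, c ⟦s⟧ * reflCoeff s (b i) (b i) := by
          rw [Finset.sum_comm]
          simp only [← Finset.mul_sum, sum_reflCoeff_self]
      _ = μ * ℓ := by
          simp only [hinner, real_inner_self_eq_norm_sq, b.norm_eq_one]
          simp [mul_comm]
  rw [hinner]
  congr 1
  field_simp
  linarith

variable {R : Type*} [CommRing R] [Algebra ℝ R]

/-- Both sides are linear in $c$, so it suffices to apply the real case to the indicator functions
of the conjugacy classes. -/
theorem sum_reflCoeff (b : OrthonormalBasis (Fin ℓ) ℝ E)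
    (hirred : ∀ U : Submodule ℝ E, (∀ w ∈ W, ∀ x ∈ U, w x ∈ U) → U = ⊥ ∨ U = ⊤)
    (c : ReflClass W → R) (y x : E) :
    ∑ s : Refl W, c ⟦s⟧ * algebraMap ℝ R (reflCoeff s y x) =
      hc ℓ c * algebraMap ℝ R (inner ℝ y x) := by
  classical
  have := Fintype.ofFinite (ReflClass W)
  have hsplit : ∀ r : Refl W → ℝ, ∑ s, c ⟦s⟧ * algebraMap ℝ R (r s) =
      ∑ o, c o * algebraMap ℝ R (∑ s : Refl W, (if ⟦s⟧ = o then 1 else 0) * r s) := by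
    intro r
    simp only [map_sum, Finset.mul_sum]
    rw [Finset.sum_comm]
    refine Finset.sum_congr rfl fun s _ => ?_
    simp [apply_ite (algebraMap ℝ R)]
  have h1 := hsplit fun _ => 1
  simp only [map_one, mul_one] at h1
  rw [hsplit, hc, h1, Finset.mul_sum, Finset.sum_mul]
  refine Finset.sum_congr rfl fun o _ => ?_
  have := sum_reflCoeff_real b hirred (fun o' => if o' = o then (1 : ℝ) else 0) y x
  rw [this, map_mul, map_mul]
  ring

end Scalar

/-! ### The contravariant form and its quotient by $1-h_c$ -/

section Form

variable {ℓ : ℕ} (b : OrthonormalBasis (Fin ℓ) ℝ E) {R : Type*} [CommRing R] [Algebra ℝ R]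
  [IsDomain R] {W : Subgroup (E ≃ₗᵢ[ℝ] E)} [Finite W]

theorem dunkl_commute (c : ReflClass W → R) (y z : E) :
    Commute (dunkl b c y) (dunkl b c z) :=
  LinearMap.ext (dunkl_comm b c y z)

theorem nabla_monomial (c : ReflClass W → R) (a : Fin ℓ →₀ ℕ) :
    nabla b c (monomial a 1) = (List.ofFn fun i : Fin ℓ => dunkl b c (b i) ^ a i).prod := by
  have := (basisMonomials (Fin ℓ) R).constr_basis R
    (fun a => (List.ofFn fun i : Fin ℓ => dunkl b c (b i) ^ a i).prod) a
  rwa [coe_basisMonomials] at this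

theorem nabla_one (c : ReflClass W → R) : nabla b c 1 = 1 := by
  have := nabla_monomial b c 0
  rw [show monomial (0 : Fin ℓ →₀ ℕ) (1 : R) = 1 from rfl] at this
  simp [this]

theorem nabla_monomial_add_single (c : ReflClass W → R) (a : Fin ℓ →₀ ℕ) (i : Fin ℓ) :
    nabla b c (monomial (a + Finsupp.single i 1) 1) =
      dunkl b c (b i) * nabla b c (monomial a 1) := by
  classical
  have h := prod_ofFn_pow_add_single (fun i => dunkl b c (b i))
    (fun i j => dunkl_commute b c _ _) a i
  rw [nabla_monomial, nabla_monomial, ← h]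
  simp only [Finsupp.add_apply, Finsupp.single_apply]

theorem nabla_X_mul (c : ReflClass W → R) (i : Fin ℓ) (f : MvPolynomial (Fin ℓ) R) :
    nabla b c (X i * f) = dunkl b c (b i) * nabla b c f := by
  refine monomial_induction (P := fun f => nabla b c (X i * f) = dunkl b c (b i) * nabla b c f)
    (fun a => ?_) (fun r f hf => ?_) (fun f g hf hg => ?_) f
  · rw [X, monomial_mul, one_mul, add_comm]
    exact nabla_monomial_add_single b c a i
  · rw [mul_smul_comm, map_smul, hf, map_smul, mul_smul_comm]
  · rw [mul_add, map_add, hf, hg, map_add, mul_add]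

theorem nabla_dunkl (c : ReflClass W → R) (y : E) (f g : MvPolynomial (Fin ℓ) R) :
    nabla b c f (dunkl b c y g) = dunkl b c y (nabla b c f g) := by
  induction f using MvPolynomial.induction_on generalizing g with
  | C r => rw [C_eq_smul_one, map_smul, nabla_one]; simp
  | add p q hp hq => simp [hp, hq]
  | mul_X p i hp =>
    rw [mul_comm, nabla_X_mul, Module.End.mul_apply, Module.End.mul_apply, hp, dunkl_comm]

theorem dunkl_sum_repr (c : ReflClass W → R) (y : E) (f : MvPolynomial (Fin ℓ) R) :
    dunkl b c y f = ∑ i, algebraMap ℝ R (inner ℝ (b i) y) • dunkl b c (b i) f := by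
  let D : E →+ MvPolynomial (Fin ℓ) R :=
    AddMonoidHom.mk' (fun y => dunkl b c y f) fun y z => by
      have h := dunkl_sub b c y (-(1 : ℝ) • z) f
      rw [dunkl_smul] at h
      simpa using h
  calc dunkl b c y f = D (∑ i, inner ℝ (b i) y • b i) := by rw [b.sum_repr']; rfl
    _ = _ := by
      rw [map_sum]
      exact Finset.sum_congr rfl fun i _ => dunkl_smul b c _ _ f

theorem form_apply (c : ReflClass W → R) (f g : MvPolynomial (Fin ℓ) R) :
    form b c f g = constantCoeff (nabla b c f g) := rfl

theorem form_C (c : ReflClass W → R) (r : R) (g : MvPolynomial (Fin ℓ) R) :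
    form b c (C r) g = r * constantCoeff g := by
  rw [form_apply, C_eq_smul_one, map_smul, nabla_one, LinearMap.smul_apply, Module.End.one_apply,
    smul_eq_C_mul, map_mul, constantCoeff_C]

theorem form_X_mul (c : ReflClass W → R) (i : Fin ℓ) (f g : MvPolynomial (Fin ℓ) R) :
    form b c (X i * f) g = form b c f (dunkl b c (b i) g) := by
  rw [form_apply, form_apply, nabla_X_mul, nabla_dunkl, Module.End.mul_apply]

theorem form_lin_mul (c : ReflClass W → R) (x : E) (f g : MvPolynomial (Fin ℓ) R) :
    form b c (lin b R x * f) g = form b c f (dunkl b c x g) := by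
  rw [lin, Finset.sum_mul, map_sum, LinearMap.sum_apply, dunkl_sum_repr b c x, map_sum]
  refine Finset.sum_congr rfl fun i _ => ?_
  rw [mul_assoc, ← smul_eq_C_mul, map_smul, LinearMap.smul_apply, form_X_mul, map_smul]

theorem form_act (c : ReflClass W → R) (w : W) (f g : MvPolynomial (Fin ℓ) R) :
    form b c (act b R w f) (act b R w g) = form b c f g := by
  refine lin_induction b (P := fun f => ∀ g, form b c (act b R w f) (act b R w g) =
    form b c f g) (fun r g => ?_) (fun f f' hf hf' g => ?_) (fun x f hf g => ?_) f g
  · rw [act_C, form_C, form_C, constantCoeff_act]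
  · simp only [map_add, LinearMap.add_apply, hf, hf']
  · rw [map_mul, act_lin, form_lin_mul, dunkl_act, hf, form_lin_mul]

theorem form_act_refl (c : ReflClass W → R) (s : Refl W) (f g : MvPolynomial (Fin ℓ) R) :
    form b c (act b R (s : W) f) g = form b c f (act b R (s : W) g) := by
  rw [← form_act b c (s : W), act_act_refl]

/-- On a product $xf$ the constant term involves only $\langle y,x\rangle-\sum_s c(s)\langle
y,x-sx\rangle$ times the constant term of $f$, and Schur's lemma evaluates this sum. This is the
source of the factor $1-h_c$. -/
theorem constantCoeff_dunkl
    (hirred : ∀ U : Submodule ℝ E, (∀ w ∈ W, ∀ x ∈ U, w x ∈ U) → U = ⊥ ∨ U = ⊤)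
    (c : ReflClass W → R) (y : E) (f : MvPolynomial (Fin ℓ) R) :
    constantCoeff (dunkl b c y f) = (1 - hc ℓ c) * constantCoeff (dirDeriv b y f) := by
  refine lin_induction b (P := fun f => constantCoeff (dunkl b c y f) =
    (1 - hc ℓ c) * constantCoeff (dirDeriv b y f)) (fun r => ?_) (fun f g hf hg => ?_)
    (fun x f _ => ?_) f
  · rw [dunkl_C, ← algebraMap_eq, Derivation.map_algebraMap, map_zero, mul_zero]
  · simp only [map_add, hf, hg, mul_add]
  · rw [dunkl_lin_mul, dirDeriv_lin_mul]
    simp only [map_sub, map_add, map_mul, map_sum, constantCoeff_lin, zero_mul, zero_add,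
      constantCoeff_C, smul_eq_C_mul, constantCoeff_act, ← Finset.sum_mul]
    rw [sum_reflCoeff b hirred]
    ring

/-- A variable that occurs in a nontrivial monomial. -/
def someVar {a : Fin ℓ →₀ ℕ} (h : a ≠ 0) : Fin ℓ :=
  (Finsupp.support_nonempty_iff.2 h).choose

theorem sub_single_someVar_add {a : Fin ℓ →₀ ℕ} (h : a ≠ 0) :
    a - Finsupp.single (someVar h) 1 + Finsupp.single (someVar h) 1 = a := by
  refine tsub_add_cancel_of_le ?_
  rw [Finsupp.single_le_iff, Nat.one_le_iff_ne_zero, ← Finsupp.mem_support_iff]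
  exact (Finsupp.support_nonempty_iff.2 h).choose_spec

/-- The quotient of the form `(f, g)_c` by `1 - h_c`, for `f` with zero constant term. -/
def phi (c : ReflClass W → R) : LinearMap.BilinForm R (MvPolynomial (Fin ℓ) R) :=
  (basisMonomials (Fin ℓ) R).constr R fun a =>
    -- The value 0 on constants is a convention, compensated by the separate constant term in
    -- `form_eq_phi`. On other monomials one factor has its Dunkl operator replaced by a derivative;
    -- commutativity lets any variable of the monomial play this role.
    if h : a = 0 then 0 else
      (lcoeff R 0 ∘ₗ (dirDeriv b (b (someVar h))).toLinearMap) ∘ₗ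
        nabla b c (monomial (a - Finsupp.single (someVar h) 1) 1)

theorem phi_monomial' (c : ReflClass W → R) (a : Fin ℓ →₀ ℕ) :
    phi b c (monomial a 1) = if h : a = 0 then 0 else
      (lcoeff R 0 ∘ₗ (dirDeriv b (b (someVar h))).toLinearMap) ∘ₗ
        nabla b c (monomial (a - Finsupp.single (someVar h) 1) 1) := by
  have := (basisMonomials (Fin ℓ) R).constr_basis R (fun a =>
    if h : a = 0 then 0 else
      (lcoeff R 0 ∘ₗ (dirDeriv b (b (someVar h))).toLinearMap) ∘ₗ
        nabla b c (monomial (a - Finsupp.single (someVar h) 1) 1)) a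
  rwa [coe_basisMonomials] at this

theorem phi_one (c : ReflClass W → R) : phi b c 1 = 0 := by
  have := phi_monomial' b c 0
  rwa [dif_pos rfl] at this

theorem phi_monomial {a : Fin ℓ →₀ ℕ} (h : a ≠ 0) (c : ReflClass W → R)
    (g : MvPolynomial (Fin ℓ) R) :
    phi b c (monomial a 1) g = constantCoeff (dirDeriv b (b (someVar h))
      (nabla b c (monomial (a - Finsupp.single (someVar h) 1) 1) g)) := by
  rw [phi_monomial', dif_neg h]
  rfl

theorem form_eq_phi
    (hirred : ∀ U : Submodule ℝ E, (∀ w ∈ W, ∀ x ∈ U, w x ∈ U) → U = ⊥ ∨ U = ⊤)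
    (c : ReflClass W → R) (f g : MvPolynomial (Fin ℓ) R) :
    form b c f g = constantCoeff f * constantCoeff g + (1 - hc ℓ c) * phi b c f g := by
  have : LinearMap.flip (form b c) g =
      constantCoeff g • lcoeff R 0 + (1 - hc ℓ c) • LinearMap.flip (phi b c) g := by
    refine linearMap_ext_monomial fun a => ?_
    simp only [LinearMap.flip_apply, LinearMap.add_apply, LinearMap.smul_apply, smul_eq_mul,
      lcoeff_apply]
    rcases eq_or_ne a 0 with rfl | ha
    · rw [show monomial (0 : Fin ℓ →₀ ℕ) (1 : R) = 1 from rfl, phi_one, LinearMap.zero_apply,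
        mul_zero, add_zero, ← C_1, coeff_C, if_pos rfl, form_C, mul_comm]
    · have h := nabla_monomial_add_single b c (a - Finsupp.single (someVar ha) 1) (someVar ha)
      rw [sub_single_someVar_add ha] at h
      rw [phi_monomial b ha, coeff_monomial, if_neg ha, mul_zero, zero_add, form_apply,
        h, Module.End.mul_apply, constantCoeff_dunkl b hirred]
  have h := LinearMap.congr_fun this f
  rwa [LinearMap.add_apply, LinearMap.smul_apply, LinearMap.smul_apply, smul_eq_mul,
    mul_comm (constantCoeff g)] at h

/-! ### Compatibility with change of coefficients -/

section Naturality

variable {R' : Type*} [CommRing R'] [Algebra ℝ R'] [IsDomain R'] (φ : R →ₐ[ℝ] R')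

theorem map_dunkl (c : ReflClass W → R) (y : E) (f : MvPolynomial (Fin ℓ) R) :
    map (φ : R →+* R') (dunkl b c y f) =
      dunkl b (fun o => φ (c o)) y (map (φ : R →+* R') f) := by
  refine lin_induction b (P := fun f => map (φ : R →+* R') (dunkl b c y f) =
    dunkl b (fun o => φ (c o)) y (map (φ : R →+* R') f)) (fun r => ?_) (fun f g hf hg => ?_)
    (fun x f hf => ?_) f
  · rw [map_C, dunkl_C, dunkl_C, map_zero]
  · simp only [map_add, hf, hg]
  · simp only [map_mul, map_lin, dunkl_lin_mul, map_sub, map_add, hf, map_sum, smul_eq_C_mul,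
      map_C, map_act, RingHom.coe_coe, AlgHom.commutes]

theorem map_dirDeriv (y : E) (f : MvPolynomial (Fin ℓ) R) :
    map (φ : R →+* R') (dirDeriv b y f) = dirDeriv b y (map (φ : R →+* R') f) := by
  -- Derivatives are the Dunkl operators with zero parameter; the trivial group serves here.
  have h := map_dunkl b φ (0 : ReflClass (⊥ : Subgroup (E ≃ₗᵢ[ℝ] E)) → R) y f
  simp only [Pi.zero_apply, map_zero] at h
  rw [dunkl_zero_param] at h
  exact h.trans (dunkl_zero_param b y _)

theorem map_nabla (c : ReflClass W → R) (f g : MvPolynomial (Fin ℓ) R) :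
    map (φ : R →+* R') (nabla b c f g) =
      nabla b (fun o => φ (c o)) (map (φ : R →+* R') f) (map (φ : R →+* R') g) := by
  induction f using MvPolynomial.induction_on generalizing g with
  | C r =>
    rw [map_C, C_eq_smul_one, C_eq_smul_one, map_smul, map_smul, nabla_one, nabla_one]
    simp [smul_eq_C_mul]
  | add p q hp hq => simp only [map_add, LinearMap.add_apply, hp, hq]
  | mul_X p i hp =>
    rw [mul_comm, map_mul (map _), map_X, nabla_X_mul, nabla_X_mul, Module.End.mul_apply,
      Module.End.mul_apply, map_dunkl, hp]

theorem form_map (c : ReflClass W → R) (f g : MvPolynomial (Fin ℓ) R) :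
    form b (fun o => φ (c o)) (map (φ : R →+* R') f) (map (φ : R →+* R') g) =
      φ (form b c f g) := by
  rw [form_apply, form_apply, ← map_nabla, constantCoeff_map, RingHom.coe_coe]

theorem phi_map (c : ReflClass W → R) (f g : MvPolynomial (Fin ℓ) R) :
    phi b (fun o => φ (c o)) (map (φ : R →+* R') f) (map (φ : R →+* R') g) =
      φ (phi b c f g) := by
  refine monomial_induction (P := fun f =>
    phi b (fun o => φ (c o)) (map (φ : R →+* R') f) (map (φ : R →+* R') g) = φ (phi b c f g))
    (fun a => ?_) (fun r f hf => ?_) (fun f f' hf hf' => ?_) f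
  · have h1 : ∀ a' : Fin ℓ →₀ ℕ, map (φ : R →+* R') (monomial a' (1 : R)) = monomial a' 1 :=
      fun a' => by rw [map_monomial, map_one]
    rw [h1]
    rcases eq_or_ne a 0 with rfl | ha
    · rw [show monomial (0 : Fin ℓ →₀ ℕ) (1 : R) = 1 from rfl,
        show monomial (0 : Fin ℓ →₀ ℕ) (1 : R') = 1 from rfl, phi_one, phi_one,
        LinearMap.zero_apply, LinearMap.zero_apply, map_zero]
    · rw [phi_monomial b ha, phi_monomial b ha, ← h1, ← map_nabla, ← map_dirDeriv,
        constantCoeff_map, RingHom.coe_coe]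
  · rw [map_smul (phi b c), LinearMap.smul_apply, smul_eq_mul, map_mul, ← hf, smul_eq_C_mul,
      map_mul (map _), map_C, ← smul_eq_C_mul, map_smul, LinearMap.smul_apply, smul_eq_mul,
      RingHom.coe_coe]
  · rw [map_add (map _), map_add, LinearMap.add_apply, hf, hf', map_add (phi b c),
      LinearMap.add_apply, map_add]

end Naturality

theorem one_sub_hc_X_ne_zero :
    1 - hc ℓ (X : ReflClass W → MvPolynomial (ReflClass W) R) ≠ 0 := by
  intro h
  have := congrArg constantCoeff h
  simp [hc] at this

/-- The recursion that replaces the monomial definition and shows independence of the chosen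
variable. It cannot be deduced from `form` when $h_c=1$, so it is proved for indeterminate
parameters, where $1-h_c$ can be cancelled, and then specialised. -/
theorem phi_lin_mul
    (hirred : ∀ U : Submodule ℝ E, (∀ w ∈ W, ∀ x ∈ U, w x ∈ U) → U = ⊥ ∨ U = ⊤)
    (c : ReflClass W → R) (x : E) (f g : MvPolynomial (Fin ℓ) R) :
    phi b c (lin b R x * f) g =
      constantCoeff f * constantCoeff (dirDeriv b x g) + phi b c f (dunkl b c x g) := by
  let A := MvPolynomial (ReflClass W) R
  have hgen : ∀ f g : MvPolynomial (Fin ℓ) A, phi b (X : ReflClass W → A) (lin b A x * f) g =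
      constantCoeff f * constantCoeff (dirDeriv b x g) +
        phi b (X : ReflClass W → A) f (dunkl b X x g) := by
    intro f g
    have h1 := form_eq_phi b hirred (X : ReflClass W → A) (lin b A x * f) g
    have h2 := form_eq_phi b hirred (X : ReflClass W → A) f (dunkl b X x g)
    rw [form_lin_mul, h2, constantCoeff_dunkl b hirred, map_mul, constantCoeff_lin, zero_mul,
      zero_mul, zero_add, mul_left_comm, ← mul_add] at h1
    exact (mul_left_cancel₀ one_sub_hc_X_ne_zero h1).symm
  -- Specialisation: coefficients are viewed as constants in the universal parameter ring, and then
  -- the variables are evaluated at `c`.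
  let ι : R →ₐ[ℝ] A := (Algebra.ofId R A).restrictScalars ℝ
  let φ : A →ₐ[ℝ] R := (aeval c).restrictScalars ℝ
  have hφι : ∀ f : MvPolynomial (Fin ℓ) R, map (φ : A →+* R) (map (ι : R →+* A) f) = f := by
    intro f
    rw [map_map]
    convert map_id f
    ext r
    simp [φ, ι]
  have hφX : (fun o => φ ((X : ReflClass W → A) o)) = c := by
    ext o
    exact aeval_X c o
  have h := congrArg φ (hgen (map (ι : R →+* A) f) (map (ι : R →+* A) g))
  rw [map_add, map_mul φ, ← phi_map, ← phi_map, hφX, map_mul (map _), map_lin, map_dunkl, hφX, hφι, hφι,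
    ← map_dirDeriv, constantCoeff_map, constantCoeff_map] at h
  have h3 : ∀ r, φ (ι r) = r := fun r => by simp [φ, ι, Algebra.ofId_apply]
  rw [RingHom.coe_coe, h3, h3] at h
  exact h

theorem phi_C (c : ReflClass W → R) (r : R) : phi b c (C r) = 0 := by
  rw [C_eq_smul_one, map_smul, phi_one, smul_zero]

theorem phi_act (hirred : ∀ U : Submodule ℝ E, (∀ w ∈ W, ∀ x ∈ U, w x ∈ U) → U = ⊥ ∨ U = ⊤)
    (c : ReflClass W → R) (w : W) (f g : MvPolynomial (Fin ℓ) R) :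
    phi b c (act b R w f) (act b R w g) = phi b c f g := by
  refine lin_induction b (P := fun f => ∀ g, phi b c (act b R w f) (act b R w g) =
    phi b c f g) (fun r g => ?_) (fun f f' hf hf' g => ?_) (fun x f hf g => ?_) f g
  · rw [act_C, phi_C, LinearMap.zero_apply, LinearMap.zero_apply]
  · rw [map_add (act b R _), map_add, map_add, LinearMap.add_apply, LinearMap.add_apply, hf, hf']
  · rw [map_mul (act b R _), act_lin, phi_lin_mul b hirred, phi_lin_mul b hirred, dunkl_act, hf,
      dirDeriv_act, constantCoeff_act, constantCoeff_act]

theorem phi_act_refl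
    (hirred : ∀ U : Submodule ℝ E, (∀ w ∈ W, ∀ x ∈ U, w x ∈ U) → U = ⊥ ∨ U = ⊤)
    (c : ReflClass W → R) (s : Refl W) (f g : MvPolynomial (Fin ℓ) R) :
    phi b c (act b R (s : W) f) g = phi b c f (act b R (s : W) g) := by
  rw [← phi_act b hirred c (s : W), act_act_refl]

end Form

/-! ### Linear algebra: transferring positivity through a self-adjoint operator -/

/-- If `B` is symmetric for a scalar product `F` and for a bilinear form `Φ`, and both
`F (B x) x` and `Φ (B x) x` are positive definite, then so is `Φ`. -/
theorem pos_of_symmetric_pair {U : Type*} [AddCommGroup U] [Module ℝ U] [FiniteDimensional ℝ U]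
    (F Φ : LinearMap.BilinForm ℝ U) (B : U →ₗ[ℝ] U) (hFs : ∀ x y, F x y = F y x)
    (hFp : ∀ x, x ≠ 0 → 0 < F x x) (hB : ∀ x y, F (B x) y = F x (B y))
    (hBp : ∀ x, x ≠ 0 → 0 < F (B x) x) (hΦ : ∀ x y, Φ (B x) y = Φ x (B y))
    (hΦp : ∀ x, x ≠ 0 → 0 < Φ (B x) x) (x : U) (hx : x ≠ 0) : 0 < Φ x x := by
  let core : InnerProductSpace.Core ℝ U :=
    { inner := fun x y => F x y
      conj_inner_symm := fun x y => hFs y x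
      re_inner_nonneg := fun x => by
        rcases eq_or_ne x 0 with rfl | h
        · simp
        · exact (hFp x h).le
      add_left := fun x y z => by simp
      smul_left := fun x y r => by simp
      definite := fun x h => by
        by_contra h0
        exact (hFp x h0).ne' h }
  let _ : NormedAddCommGroup U := core.toNormedAddCommGroup
  let _ : InnerProductSpace ℝ U := InnerProductSpace.ofCore core.toCore
  have hin : ∀ x y : U, inner ℝ x y = F x y := fun _ _ => rfl
  have hsym : B.IsSymmetric := fun x y => hB x y
  let e := hsym.eigenvectorBasis rfl
  let μ := hsym.eigenvalues rfl
  have he : ∀ i, B (e i) = μ i • e i := fun i => hsym.apply_eigenvectorBasis rfl i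
  have he0 : ∀ i, e i ≠ 0 := e.orthonormal.ne_zero
  have hμ : ∀ i, 0 < μ i := by
    intro i
    have h := hBp (e i) (he0 i)
    rw [he, map_smul, LinearMap.smul_apply, smul_eq_mul] at h
    exact (pos_iff_pos_of_mul_pos h).2 (hFp _ (he0 i))
  have hcross : ∀ i j, μ i ≠ μ j → Φ (e i) (e j) = 0 := by
    intro i j hij
    have h := hΦ (e i) (e j)
    rw [he, he, map_smul, map_smul, LinearMap.smul_apply, smul_eq_mul, smul_eq_mul] at h
    by_contra h0
    exact hij (mul_right_cancel₀ h0 h)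
  let ξ := fun i => inner ℝ (e i) x
  have hxξ : x = ∑ i, ξ i • e i := (e.sum_repr' x).symm
  -- The vector $B^{-1/2}x$, written in an eigenbasis of `B` orthonormal for `F`.
  let y : U := ∑ i, (ξ i / √(μ i)) • e i
  have hy : Φ (B y) y = Φ x x := by
    have hBy : B y = ∑ i, (ξ i * √(μ i)) • e i := by
      simp only [y, map_sum, map_smul, he, smul_smul]
      refine Finset.sum_congr rfl fun i _ => ?_
      congr 1
      rw [div_mul_eq_mul_div, mul_div_assoc, Real.div_sqrt]
    rw [hBy, hxξ]
    simp only [y, map_sum, map_smul, LinearMap.sum_apply, LinearMap.smul_apply, smul_eq_mul,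
      Finset.mul_sum]
    refine Finset.sum_congr rfl fun i _ => Finset.sum_congr rfl fun j _ => ?_
    -- For equal eigenvalues the square roots cancel; eigenvectors with distinct eigenvalues are
    -- `Φ`-orthogonal.
    by_cases hij : μ i = μ j
    · have hs : √(μ j) ≠ 0 := (Real.sqrt_pos.2 (hμ j)).ne'
      rw [hij]
      field_simp
    · simp [hcross _ _ (Ne.symm hij)]
  rw [← hy]
  refine hΦp y fun h0 => hx ?_
  have hξ : ∀ i, ξ i = 0 := by
    intro i
    have h := congrArg (fun v => inner ℝ (e i) v) h0
    simp only [y, inner_zero_right] at h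
    rw [e.orthonormal.inner_right_fintype] at h
    exact (div_eq_zero_iff.1 h).resolve_right (Real.sqrt_pos.2 (hμ i)).ne'
  rw [hxξ]
  simp [hξ]

theorem finsupp_add_single_induction {σ : Type*} {P : (σ →₀ ℕ) → Prop} (h0 : P 0)
    (h1 : ∀ a i, P a → P (a + Finsupp.single i 1)) (a : σ →₀ ℕ) : P a := by
  induction a using Finsupp.induction with
  | zero => exact h0
  | single_add i n f _ _ hf =>
    clear * - hf h1
    induction n with
    | zero => simpa using hf
    | succ n ih =>
      have := h1 _ i ih
      rwa [add_right_comm, ← Finsupp.single_add] at this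

/-! ### Degrees and the operator $\sum x_i\nabla_{x_i}$ -/

section Graded

variable {ℓ : ℕ} (b : OrthonormalBasis (Fin ℓ) ℝ E) {R : Type*} [CommRing R] [Algebra ℝ R]
  [IsDomain R] {W : Subgroup (E ≃ₗᵢ[ℝ] E)} [Finite W]

theorem isHomogeneous_dunkl_monomial (c : ReflClass W → R) (y : E) (a : Fin ℓ →₀ ℕ) :
    ∀ n, a.degree = n + 1 → (dunkl b c y (monomial a 1)).IsHomogeneous n := by
  induction a using finsupp_add_single_induction with
  | h0 => intro n hn; simp at hn
  | h1 a i ih =>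
    intro n hn
    rw [map_add, Finsupp.degree_single, add_left_inj] at hn
    have hm : (monomial a (1 : R)).IsHomogeneous n := isHomogeneous_monomial _ hn
    rw [monomial_add_single_eq b, dunkl_lin_mul]
    refine ((IsHomogeneous.add ?_ (hm.C_mul _)).sub
      (IsHomogeneous.sum _ _ _ fun s _ => ?_))
    -- In degree one the remaining factor is constant and is killed by the Dunkl operator, so the
    -- induction hypothesis is needed only above that degree.
    · cases n with
      | zero =>
        rw [Finsupp.degree_eq_zero_iff] at hn
        subst hn
        rw [show monomial (0 : Fin ℓ →₀ ℕ) (1 : R) = C 1 from rfl, dunkl_C, mul_zero]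
        exact isHomogeneous_zero _ _ _
      | succ n =>
        rw [add_comm]
        exact (isHomogeneous_lin b R _).mul (ih n hn)
    · rw [smul_eq_C_mul]
      exact (hm.act b _).C_mul _

theorem _root_.MvPolynomial.IsHomogeneous.dunkl {f : MvPolynomial (Fin ℓ) R} {n : ℕ}
    (hf : f.IsHomogeneous (n + 1)) (c : ReflClass W → R) (y : E) :
    (dunkl b c y f).IsHomogeneous n := by
  rw [f.as_sum, map_sum]
  refine IsHomogeneous.sum _ _ _ fun a ha => ?_
  rw [← mul_one (coeff a f), ← smul_eq_mul, ← smul_monomial, map_smul, smul_eq_C_mul]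
  refine (isHomogeneous_dunkl_monomial b c y a n ?_).C_mul _
  by_contra h
  exact (mem_support_iff.1 ha) (hf.coeff_eq_zero h)

theorem _root_.MvPolynomial.IsHomogeneous.dirDeriv {f : MvPolynomial (Fin ℓ) R} {n : ℕ}
    (hf : f.IsHomogeneous (n + 1)) (y : E) : (dirDeriv b y f).IsHomogeneous n := by
  rw [← dunkl_zero_param (W := (⊥ : Subgroup (E ≃ₗᵢ[ℝ] E)))]
  exact hf.dunkl b _ _

theorem phi_monomial_eq_zero
    (hirred : ∀ U : Submodule ℝ E, (∀ w ∈ W, ∀ x ∈ U, w x ∈ U) → U = ⊥ ∨ U = ⊤)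
    (c : ReflClass W → R) (a : Fin ℓ →₀ ℕ) :
    ∀ (n : ℕ) (g : MvPolynomial (Fin ℓ) R), g.IsHomogeneous n → a.degree ≠ n →
      phi b c (monomial a 1) g = 0 := by
  induction a using finsupp_add_single_induction with
  | h0 =>
    intro n g _ _
    rw [show monomial (0 : Fin ℓ →₀ ℕ) (1 : R) = C 1 from rfl, phi_C, LinearMap.zero_apply]
  | h1 a i ih =>
    intro n g hg hn
    rw [monomial_add_single_eq b, phi_lin_mul b hirred]
    cases n with
    | zero =>
      rw [← mem_homogeneousSubmodule, homogeneousSubmodule_zero, Submodule.mem_one] at hg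
      obtain ⟨r, rfl⟩ := hg
      rw [Derivation.map_algebraMap, algebraMap_eq, dunkl_C, map_zero, map_zero, mul_zero,
        add_zero]
    | succ n =>
      rw [map_add, Finsupp.degree_single, ne_eq, add_left_inj] at hn
      rw [ih n _ (hg.dunkl b c _) hn, add_zero]
      rcases eq_or_ne a 0 with rfl | ha
      · have h : constantCoeff (dirDeriv b (b i) g) = 0 :=
          (hg.dirDeriv b (b i)).coeff_eq_zero hn
        rw [h, mul_zero]
      · rw [constantCoeff_monomial, if_neg ha, zero_mul]

theorem phi_eq_zero_of_isHomogeneous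
    (hirred : ∀ U : Submodule ℝ E, (∀ w ∈ W, ∀ x ∈ U, w x ∈ U) → U = ⊥ ∨ U = ⊤)
    (c : ReflClass W → R) {m n : ℕ} (hmn : m ≠ n) {f g : MvPolynomial (Fin ℓ) R}
    (hf : f.IsHomogeneous m) (hg : g.IsHomogeneous n) : phi b c f g = 0 := by
  rw [f.as_sum, map_sum, LinearMap.sum_apply]
  refine Finset.sum_eq_zero fun a ha => ?_
  rw [← mul_one (coeff a f), ← smul_eq_mul, ← smul_monomial, map_smul, LinearMap.smul_apply,
    phi_monomial_eq_zero b hirred c a n g hg, smul_zero]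
  by_contra h
  refine mem_support_iff.1 ha (hf.coeff_eq_zero ?_)
  rw [h]
  exact hmn.symm

/-- The operator `∑ x_i ∇_{x_i}`. -/
def euler (c : ReflClass W → R) : Module.End R (MvPolynomial (Fin ℓ) R) :=
  ∑ i, LinearMap.mulLeft R (X i) ∘ₗ dunkl b c (b i)

theorem euler_apply (c : ReflClass W → R) (f : MvPolynomial (Fin ℓ) R) :
    euler b c f = ∑ i, X i * dunkl b c (b i) f := by
  simp [euler, LinearMap.sum_apply]

/-- Summing $x_i\langle x_i,\alpha_s\rangle$ over the basis reproduces $\alpha_s$, which cancels the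
denominator of the divided difference. -/
theorem euler_eq (c : ReflClass W → R) (f : MvPolynomial (Fin ℓ) R) :
    euler b c f = ∑ i, X i * pderiv i f - ∑ s : Refl W, c ⟦s⟧ • (f - act b R (s : W) f) := by
  simp only [euler_apply, dunkl_apply, mul_sub, Finset.sum_sub_distrib, dirDeriv_basis,
    Finset.mul_sum]
  congr 1
  rw [Finset.sum_comm]
  refine Finset.sum_congr rfl fun s _ => ?_
  rw [← root_mul_divDiff, lin, Finset.sum_mul, Finset.smul_sum]
  refine Finset.sum_congr rfl fun i _ => ?_
  rw [smul_eq_C_mul, smul_eq_C_mul, C_mul]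
  ring

theorem euler_of_isHomogeneous (c : ReflClass W → R) {f : MvPolynomial (Fin ℓ) R} {n : ℕ}
    (hf : f.IsHomogeneous n) :
    euler b c f = n • f - ∑ s : Refl W, c ⟦s⟧ • (f - act b R (s : W) f) := by
  rw [euler_eq, hf.sum_X_mul_pderiv]

theorem _root_.MvPolynomial.IsHomogeneous.euler (c : ReflClass W → R)
    {f : MvPolynomial (Fin ℓ) R} {n : ℕ} (hf : f.IsHomogeneous n) :
    (euler b c f).IsHomogeneous n := by
  rw [euler_of_isHomogeneous b c hf, nsmul_eq_mul, ← map_natCast (C : R →+* _)]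
  refine (hf.C_mul _).sub (IsHomogeneous.sum _ _ _ fun s _ => ?_)
  rw [smul_eq_C_mul]
  exact (hf.sub (hf.act b _)).C_mul _

/-- A form for which the reflections are self-adjoint makes `∑ x_i ∇_{x_i}` self-adjoint in each
degree. -/
theorem bilin_euler_comm (Φ : LinearMap.BilinForm R (MvPolynomial (Fin ℓ) R))
    (hΦ : ∀ (s : Refl W) f g, Φ (act b R (s : W) f) g = Φ f (act b R (s : W) g))
    (c : ReflClass W → R) {n : ℕ} {f g : MvPolynomial (Fin ℓ) R} (hf : f.IsHomogeneous n)
    (hg : g.IsHomogeneous n) : Φ (euler b c f) g = Φ f (euler b c g) := by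
  rw [euler_of_isHomogeneous b c hf, euler_of_isHomogeneous b c hg]
  simp only [map_sub, map_nsmul, map_sum, map_smul, LinearMap.sub_apply, LinearMap.smul_apply,
    LinearMap.sum_apply, hΦ]

/-- The derivative term of `phi_lin_mul` drops out because $\nabla_{x_i}f$ has positive degree; this
is why the degree is at least two. -/
theorem phi_euler
    (hirred : ∀ U : Submodule ℝ E, (∀ w ∈ W, ∀ x ∈ U, w x ∈ U) → U = ⊥ ∨ U = ⊤)
    (c : ReflClass W → R) {n : ℕ} {f : MvPolynomial (Fin ℓ) R} (hf : f.IsHomogeneous (n + 2))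
    (g : MvPolynomial (Fin ℓ) R) :
    phi b c (euler b c f) g = ∑ i, phi b c (dunkl b c (b i) f) (dunkl b c (b i) g) := by
  rw [euler_apply, map_sum, LinearMap.sum_apply]
  refine Finset.sum_congr rfl fun i _ => ?_
  have h : constantCoeff (dunkl b c (b i) f) = 0 := (hf.dunkl b c (b i)).coeff_eq_zero (by simp)
  rw [← lin_basis b R i, phi_lin_mul b hirred, h, zero_mul, zero_add]

end Graded

/-! ### The Fischer form and the contribution of one reflection -/

section Fischer

variable {W : Subgroup (E ≃ₗᵢ[ℝ] E)}

/-- The unit root of a reflection. -/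
def unitRoot (s : Refl W) : E := ‖root s‖⁻¹ • root s

theorem norm_unitRoot (s : Refl W) : ‖unitRoot s‖ = 1 := by
  rw [unitRoot, norm_smul, norm_inv, norm_norm,
    inv_mul_cancel₀ (norm_ne_zero_iff.2 (root_ne_zero s))]

theorem refl_unitRoot (s : Refl W) : ((s : W) : E ≃ₗᵢ[ℝ] E) (unitRoot s) = -unitRoot s := by
  rw [unitRoot, map_smul, refl_apply, real_inner_self_eq_norm_sq,
    div_self (norm_root_sq_ne_zero s), mul_one, two_smul, ← smul_neg]
  congr 1
  abel

theorem reflCoeff_eq_unitRoot (s : Refl W) (y x : E) :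
    reflCoeff s y x = 2 * inner ℝ y (unitRoot s) * inner ℝ x (unitRoot s) := by
  have := norm_ne_zero_iff.2 (root_ne_zero s)
  rw [reflCoeff_eq, unitRoot, inner_smul_right, inner_smul_right, real_inner_comm x]
  field_simp

variable {ℓ : ℕ} (b : OrthonormalBasis (Fin ℓ) ℝ E)

theorem two_lin_unitRoot_mul_dirDeriv (s : Refl W) (f : MvPolynomial (Fin ℓ) ℝ) :
    (2 : ℝ) • (lin b ℝ (unitRoot s) * dirDeriv b (unitRoot s) f) =
      ∑ i, ∑ j, reflCoeff s (b i) (b j) • (X i * pderiv j f) := by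
  rw [lin, dirDeriv_apply, Finset.sum_mul_sum, Finset.smul_sum]
  refine Finset.sum_congr rfl fun i _ => ?_
  rw [Finset.smul_sum]
  refine Finset.sum_congr rfl fun j _ => ?_
  rw [reflCoeff_eq_unitRoot, Algebra.algebraMap_self, RingHom.id_apply, RingHom.id_apply,
    ← smul_eq_C_mul, smul_mul_smul_comm, smul_smul, mul_assoc]

/-- The $s$-odd part of a polynomial is divisible by the root, and the quotient is $s$-even because
the root is odd. -/
theorem exists_even_add_lin_mul_even (s : Refl W) (f : MvPolynomial (Fin ℓ) ℝ) :
    ∃ e k, f = e + lin b ℝ (unitRoot s) * k ∧ act b ℝ (s : W) e = e ∧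
      act b ℝ (s : W) k = k := by
  have hr := norm_ne_zero_iff.2 (root_ne_zero s)
  have hk : lin b ℝ (unitRoot s) * ((‖root s‖ / 2) • divDiff b ℝ s f) =
      (1 / 2 : ℝ) • (f - act b ℝ (s : W) f) := by
    rw [← root_mul_divDiff, unitRoot, lin_smul, Algebra.algebraMap_self, RingHom.id_apply,
      ← smul_eq_C_mul, smul_mul_smul_comm]
    congr 1
    field_simp
  refine ⟨(1 / 2 : ℝ) • (f + act b ℝ (s : W) f), (‖root s‖ / 2) • divDiff b ℝ s f, ?_, ?_, ?_⟩
  · rw [hk]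
    module
  · rw [map_smul, map_add, act_act_refl, add_comm]
  · have hu : lin b ℝ (unitRoot s) ≠ 0 := lin_ne_zero b ℝ (by
      rw [← norm_ne_zero_iff, norm_unitRoot]
      exact one_ne_zero)
    apply mul_left_cancel₀ hu
    have h := congrArg (act b ℝ (s : W)) hk
    have h' : lin b ℝ (-unitRoot s) = -lin b ℝ (unitRoot s) := by
      simpa using lin_smul b ℝ (-1) (unitRoot s)
    rw [map_mul, act_lin, refl_unitRoot, h', map_smul (act b ℝ (s : W)) (1 / 2 : ℝ), map_sub,
      act_act_refl] at h
    rw [neg_mul, neg_eq_iff_eq_neg] at h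
    rw [hk, h]
    module

variable [Finite W]

/-- At $c=0$ the form differentiates, so it is diagonal in the monomials with factorial weights.
Symmetry and positive definiteness follow. -/
theorem form_zero_monomial (a : Fin ℓ →₀ ℕ) (g : MvPolynomial (Fin ℓ) ℝ) :
    form b (0 : ReflClass W → ℝ) (monomial a 1) g =
      (∏ i, ((a i).factorial : ℝ)) * coeff a g := by
  classical
  induction a using finsupp_add_single_induction generalizing g with
  | h0 =>
    rw [show monomial (0 : Fin ℓ →₀ ℕ) (1 : ℝ) = C 1 from rfl, form_C]
    simp [constantCoeff_eq]
  | h1 a i ih =>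
    rw [monomial_add_single_eq b, form_lin_mul, dunkl_zero_param, dirDeriv_basis, ih,
      coeff_pderiv]
    have h : ∏ j, (((a + Finsupp.single i 1 : Fin ℓ →₀ ℕ) j).factorial : ℝ) =
        (a i + 1) * ∏ j, ((a j).factorial : ℝ) := by
      rw [← Finset.mul_prod_erase _ _ (Finset.mem_univ i),
        ← Finset.mul_prod_erase _ (fun j => ((a j).factorial : ℝ)) (Finset.mem_univ i),
        ← mul_assoc]
      congr 1
      · simp [Nat.factorial_succ]
      · refine Finset.prod_congr rfl fun j hj => ?_
        simp [(Finset.ne_of_mem_erase hj).symm]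
    rw [h]
    ring

theorem form_zero_eq_sum {f : MvPolynomial (Fin ℓ) ℝ} {T : Finset (Fin ℓ →₀ ℕ)}
    (hT : f.support ⊆ T) (g : MvPolynomial (Fin ℓ) ℝ) :
    form b (0 : ReflClass W → ℝ) f g =
      ∑ a ∈ T, coeff a f * ((∏ i, ((a i).factorial : ℝ)) * coeff a g) := by
  conv_lhs => rw [f.as_sum, map_sum, LinearMap.sum_apply]
  rw [← Finset.sum_subset hT]
  · refine Finset.sum_congr rfl fun a _ => ?_
    rw [← mul_one (coeff a f), ← smul_eq_mul, ← smul_monomial, map_smul, LinearMap.smul_apply,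
      form_zero_monomial, smul_eq_mul, smul_eq_mul, mul_one]
  · intro a _ ha
    rw [notMem_support_iff.1 ha, zero_mul]

theorem form_zero_symm (f g : MvPolynomial (Fin ℓ) ℝ) :
    form b (0 : ReflClass W → ℝ) f g = form b (0 : ReflClass W → ℝ) g f := by
  classical
  rw [form_zero_eq_sum b (Finset.subset_union_left (s₂ := g.support)),
    form_zero_eq_sum b (Finset.subset_union_right (s₁ := f.support))]
  refine Finset.sum_congr rfl fun a _ => ?_
  ring

theorem form_zero_pos {f : MvPolynomial (Fin ℓ) ℝ} (hf : f ≠ 0) :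
    0 < form b (0 : ReflClass W → ℝ) f f := by
  rw [form_zero_eq_sum b subset_rfl]
  refine Finset.sum_pos (fun a ha => ?_) (support_nonempty.2 hf)
  have h1 : (0 : ℝ) < ∏ i, ((a i).factorial : ℝ) :=
    Finset.prod_pos fun i _ => Nat.cast_pos.2 (Nat.factorial_pos _)
  have h2 := mul_self_pos.2 (mem_support_iff.1 ha)
  rw [mul_left_comm]
  exact mul_pos h1 h2

theorem form_zero_nonneg (f : MvPolynomial (Fin ℓ) ℝ) :
    0 ≤ form b (0 : ReflClass W → ℝ) f f := by
  rcases eq_or_ne f 0 with rfl | h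
  · simp
  · exact (form_zero_pos b h).le

theorem form_zero_self_eq_zero {f : MvPolynomial (Fin ℓ) ℝ}
    (h : form b (0 : ReflClass W → ℝ) f f = 0) : f = 0 := by
  by_contra h0
  exact (form_zero_pos (W := W) b h0).ne' h

/-- The contribution of one reflection to `∑ x_i ∇_{x_i}` on the hyperplane `h_c = 1`. -/
def reflEuler (s : Refl W) (f : MvPolynomial (Fin ℓ) ℝ) : MvPolynomial (Fin ℓ) ℝ :=
  (2 : ℝ) • (lin b ℝ (unitRoot s) * dirDeriv b (unitRoot s) f) - (f - act b ℝ (s : W) f)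

/-- When $h_c=1$, Schur's lemma gives $\sum_s 2c(s)\,u_s\otimes u_s=\sum_i x_i\otimes x_i$. The
Euler field thus splits over the reflections and can be paired with the terms $1-s$. -/
theorem euler_eq_sum_reflEuler
    (hirred : ∀ U : Submodule ℝ E, (∀ w ∈ W, ∀ x ∈ U, w x ∈ U) → U = ⊥ ∨ U = ⊤)
    (c : ReflClass W → ℝ) (hc1 : hc ℓ c = 1) (f : MvPolynomial (Fin ℓ) ℝ) :
    euler b c f = ∑ s : Refl W, c ⟦s⟧ • reflEuler b s f := by
  classical
  rw [euler_eq]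
  simp only [reflEuler, smul_sub (c _) (_ • _), Finset.sum_sub_distrib]
  congr 1
  simp only [two_lin_unitRoot_mul_dirDeriv, Finset.smul_sum, smul_smul]
  rw [Finset.sum_comm]
  refine Finset.sum_congr rfl fun i _ => ?_
  rw [Finset.sum_comm]
  have h : ∀ j, ∑ s : Refl W, (c ⟦s⟧ * reflCoeff s (b i) (b j)) • (X i * pderiv j f) =
      (if i = j then (1 : ℝ) else 0) • (X i * pderiv j f) := by
    intro j
    have := sum_reflCoeff b hirred c (b i) (b j)
    simp only [Algebra.algebraMap_self, RingHom.id_apply, hc1, one_mul, b.inner_eq_ite] at this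
    rw [← Finset.sum_smul, this]
  simp [h]

theorem form_zero_odd_even (s : Refl W) {f g : MvPolynomial (Fin ℓ) ℝ}
    (hf : act b ℝ (s : W) f = -f) (hg : act b ℝ (s : W) g = g) :
    form b (0 : ReflClass W → ℝ) f g = 0 := by
  have h := form_act b (0 : ReflClass W → ℝ) (s : W) f g
  rw [hf, hg, map_neg, LinearMap.neg_apply] at h
  linarith

/-- For $f=e+uk$ with $e,k$ even, the odd part of the difference loses its term $2uk$, leaving
$2u\,\partial_u e+2u^2\partial_u k$. Since $u$ is adjoint to $\partial_u$ and parities are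
orthogonal, the value is $2(|\partial_u e|^2+|\partial_u k|^2+|u\,\partial_u k|^2)$ in the Fischer
norm. -/
theorem form_zero_reflEuler (s : Refl W) (f : MvPolynomial (Fin ℓ) ℝ) :
    0 ≤ form b (0 : ReflClass W → ℝ) (reflEuler b s f) f ∧
      (form b (0 : ReflClass W → ℝ) (reflEuler b s f) f = 0 →
        dirDeriv b (unitRoot s) (dirDeriv b (unitRoot s) f) = 0) := by
  obtain ⟨e, k, rfl, he, hk⟩ := exists_even_add_lin_mul_even b s f
  set u := unitRoot s with hu
  set F := form b (0 : ReflClass W → ℝ) with hF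
  have huu : (inner ℝ u u : ℝ) = 1 := by
    rw [real_inner_self_eq_norm_sq, hu, norm_unitRoot, one_pow]
  have hsu : ((s : W) : E ≃ₗᵢ[ℝ] E) u = -u := refl_unitRoot s
  have hlin : lin b ℝ (-u) = -lin b ℝ u := by
    simpa using lin_smul b ℝ (-1) u
  have hder : ∀ p : MvPolynomial (Fin ℓ) ℝ, dirDeriv b (-u) p = -dirDeriv b u p := by
    intro p
    simpa using dirDeriv_smul b (-1) u p
  have hleib : ∀ p : MvPolynomial (Fin ℓ) ℝ,
      dirDeriv b u (lin b ℝ u * p) = lin b ℝ u * dirDeriv b u p + p := by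
    intro p
    rw [dirDeriv_lin_mul, huu]
    simp
  have hadj : ∀ p q : MvPolynomial (Fin ℓ) ℝ, F (lin b ℝ u * p) q = F p (dirDeriv b u q) := by
    intro p q
    rw [hF, form_lin_mul, dunkl_zero_param]
  have hdact : ∀ p : MvPolynomial (Fin ℓ) ℝ,
      act b ℝ (s : W) (dirDeriv b u p) = -dirDeriv b u (act b ℝ (s : W) p) := by
    intro p
    rw [← dirDeriv_act, hsu, hder]
  have hP : reflEuler b s (e + lin b ℝ u * k) =
      (2 : ℝ) • (lin b ℝ u * dirDeriv b u e) +
        (2 : ℝ) • (lin b ℝ u * (lin b ℝ u * dirDeriv b u k)) := by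
    rw [reflEuler, ← hu, map_add, map_add, map_mul (act b ℝ _), act_lin, he, hk, hsu, hlin, hleib]
    simp only [smul_eq_C_mul, map_ofNat]
    ring
  have hde : act b ℝ (s : W) (dirDeriv b u e) = -dirDeriv b u e := by rw [hdact, he]
  have hdk : act b ℝ (s : W) (dirDeriv b u k) = -dirDeriv b u k := by rw [hdact, hk]
  have hudk : act b ℝ (s : W) (lin b ℝ u * dirDeriv b u k) = lin b ℝ u * dirDeriv b u k := by
    rw [map_mul, act_lin, hsu, hlin, hdk, neg_mul_neg]
  have hval : F (reflEuler b s (e + lin b ℝ u * k)) (e + lin b ℝ u * k) =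
      2 * (F (dirDeriv b u e) (dirDeriv b u e) + F (dirDeriv b u k) (dirDeriv b u k) +
        F (lin b ℝ u * dirDeriv b u k) (lin b ℝ u * dirDeriv b u k)) := by
    have h1 : F (dirDeriv b u e) (lin b ℝ u * dirDeriv b u k) = 0 :=
      form_zero_odd_even b s hde hudk
    have h2 : F (lin b ℝ u * dirDeriv b u k) (dirDeriv b u e) = 0 := by
      rw [hF, form_zero_symm, ← hF, h1]
    have h3 : F (dirDeriv b u e) k = 0 := form_zero_odd_even b s hde hk
    have h4 : F (lin b ℝ u * dirDeriv b u k) k = F (dirDeriv b u k) (dirDeriv b u k) :=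
      hadj _ _
    rw [hP, map_add F, map_smul, map_smul, LinearMap.add_apply, LinearMap.smul_apply,
      LinearMap.smul_apply, hadj, hadj, map_add (dirDeriv b u), hleib, map_add, map_add, map_add,
      map_add, h1, h2, h3, h4, smul_eq_mul, smul_eq_mul]
    ring
  have p1 := form_zero_nonneg (W := W) b (dirDeriv b u e)
  have p2 := form_zero_nonneg (W := W) b (dirDeriv b u k)
  have p3 := form_zero_nonneg (W := W) b (lin b ℝ u * dirDeriv b u k)
  rw [← hF] at p1 p2 p3
  rw [hval]
  refine ⟨by linarith, fun h => ?_⟩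
  -- If the sum of squares vanishes, then $e$ and $k$ are constant along $u$ and $f$ is affine in
  -- that direction.
  have e1 : dirDeriv b u e = 0 := form_zero_self_eq_zero (W := W) b (by linarith)
  have e2 : dirDeriv b u k = 0 := form_zero_self_eq_zero (W := W) b (by linarith)
  rw [map_add, hleib, e1, e2, mul_zero, zero_add, zero_add, e2]

end Fischer

/-! ### Symmetric bilinear maps vanishing on the squares of the roots -/

section Roots

variable {ℓ : ℕ} {W : Subgroup (E ≃ₗᵢ[ℝ] E)}

/-- The reflections send roots to multiples of roots. -/
theorem exists_root_eq_smul (s t : Refl W) :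
    ∃ (r : Refl W) (κ : ℝ), ((t : W) : E ≃ₗᵢ[ℝ] E) (root s) = κ • root r := by
  refine ⟨conjRefl t s, ?_⟩
  set v := ((t : W) : E ≃ₗᵢ[ℝ] E) (root s) with hv
  have h1 : (((conjRefl (t : W) s : Refl W) : W) : E ≃ₗᵢ[ℝ] E) v = -v := by
    have h : (((conjRefl (t : W) s : Refl W) : W) : E ≃ₗᵢ[ℝ] E) v =
        ((t : W) : E ≃ₗᵢ[ℝ] E) (((s : W) : E ≃ₗᵢ[ℝ] E) (root s)) :=
      congrArg (fun g : W => (g : E ≃ₗᵢ[ℝ] E) (root s)) (coe_conjRefl_mul (t : W) s)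
    rw [h, refl_apply s, real_inner_self_eq_norm_sq, div_self (norm_root_sq_ne_zero s), mul_one,
      two_smul, ← sub_sub, sub_self, zero_sub, map_neg]
  have h2 := sub_refl_apply (conjRefl (t : W) s) v
  rw [h1, sub_neg_eq_add, ← two_smul ℝ] at h2
  refine ⟨inner ℝ (root (conjRefl (t : W) s)) v / ‖root (conjRefl (t : W) s)‖ ^ 2, ?_⟩
  rw [mul_smul] at h2
  exact smul_right_injective _ (two_ne_zero (α := ℝ)) h2

/-- A subspace stable under all reflections of `W` is trivial or everything. -/
theorem eq_bot_or_eq_top_of_refl_mem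
    (hgen : Subgroup.closure {s | s ∈ W ∧ IsReflection s} = W)
    (hirred : ∀ U : Submodule ℝ E, (∀ w ∈ W, ∀ x ∈ U, w x ∈ U) → U = ⊥ ∨ U = ⊤)
    (U : Submodule ℝ E) (hU : ∀ s : Refl W, ∀ x ∈ U, ((s : W) : E ≃ₗᵢ[ℝ] E) x ∈ U) :
    U = ⊥ ∨ U = ⊤ := by
  refine hirred U fun w hw => ?_
  rw [← hgen] at hw
  induction hw using Subgroup.closure_induction'' with
  | mem s hs => exact hU ⟨⟨s, hs.1⟩, hs.2⟩
  | inv_mem s hs =>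
    intro x hx
    have : (s⁻¹ : E ≃ₗᵢ[ℝ] E) = s :=
      congrArg Subtype.val (inv_eq_of_mul_eq_one_left (refl_mul_self ⟨⟨s, hs.1⟩, hs.2⟩))
    rw [this]
    exact hU ⟨⟨s, hs.1⟩, hs.2⟩ x hx
  | one => exact fun x hx => hx
  | mul v w _ _ hv hw => exact fun x hx => hv _ (hw x hx)

/-- A symmetric bilinear map on an irreducible reflection representation that vanishes on the
squares of the roots is zero. -/
theorem bilin_eq_zero_of_root_self {M : Type*} [AddCommGroup M] [Module ℝ M]
    (hgen : Subgroup.closure {s | s ∈ W ∧ IsReflection s} = W)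
    (hirred : ∀ U : Submodule ℝ E, (∀ w ∈ W, ∀ x ∈ U, w x ∈ U) → U = ⊥ ∨ U = ⊤)
    (hne : Nonempty (Refl W)) (T : E →ₗ[ℝ] E →ₗ[ℝ] M) (hsymm : ∀ x y, T x y = T y x)
    (hroot : ∀ s : Refl W, T (root s) (root s) = 0) : T = 0 := by
  -- For two non-orthogonal roots, expanding the square of the reflected root leaves only a nonzero
  -- multiple of the mixed term.
  have h1 : ∀ s t : Refl W, inner ℝ (root s) (root t) ≠ (0 : ℝ) →
      T (root s) (root t) = 0 := by
    intro s t hst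
    obtain ⟨r, κ, hr⟩ := exists_root_eq_smul t s
    have h0 : T (((s : W) : E ≃ₗᵢ[ℝ] E) (root t)) (((s : W) : E ≃ₗᵢ[ℝ] E) (root t)) = 0 := by
      rw [hr, map_smul, map_smul, LinearMap.smul_apply, hroot, smul_zero, smul_zero]
    rw [refl_apply, map_sub, map_sub, LinearMap.sub_apply, LinearMap.sub_apply, map_smul,
      map_smul, LinearMap.smul_apply, LinearMap.smul_apply, map_smul, hroot, hroot,
      hsymm (root t), smul_zero, smul_zero, zero_sub, sub_zero, ← neg_add', neg_eq_zero,
      ← two_smul ℝ, smul_smul] at h0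
    refine (smul_eq_zero.1 h0).resolve_left ?_
    exact mul_ne_zero two_ne_zero
      (mul_ne_zero two_ne_zero (div_ne_zero hst (norm_root_sq_ne_zero s)))
  have h2 : ∀ s : Refl W, T (root s) = 0 := by
    intro s
    -- The roots not orthogonal to a fixed root span a reflection-stable subspace. A reflection
    -- whose root is orthogonal to the fixed one preserves the inner product with it; any other
    -- reflection subtracts a multiple of a root already in the set.
    have hspan := eq_bot_or_eq_top_of_refl_mem hgen hirred
      (Submodule.span ℝ {v | ∃ t : Refl W, v = root t ∧ inner ℝ (root s) (root t) ≠ (0 : ℝ)}) ?_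
    · have htop := hspan.resolve_left fun hbot => root_ne_zero s ((Submodule.mem_bot ℝ).1 (hbot ▸
        Submodule.subset_span ⟨s, rfl, by
          rw [real_inner_self_eq_norm_sq]
          exact norm_root_sq_ne_zero s⟩))
      refine LinearMap.ext_on htop ?_
      rintro _ ⟨t, rfl, ht⟩
      exact h1 s t ht
    · intro t x hx
      induction hx using Submodule.span_induction with
      | zero => simp
      | add x y _ _ hx hy => rw [map_add]; exact add_mem hx hy
      | smul r x _ hx => rw [map_smul]; exact Submodule.smul_mem _ _ hx
      | mem x hx =>
        obtain ⟨t', rfl, ht'⟩ := hx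
        by_cases hst : inner ℝ (root s) (root t) = (0 : ℝ)
        · obtain ⟨r, κ, hr⟩ := exists_root_eq_smul t' t
          rw [hr]
          refine Submodule.smul_mem _ _ (Submodule.subset_span ⟨r, rfl, fun h0 => ht' ?_⟩)
          have h3 : inner ℝ (root s) (((t : W) : E ≃ₗᵢ[ℝ] E) (root t')) = (0 : ℝ) := by
            rw [hr, inner_smul_right, h0, mul_zero]
          rwa [refl_apply, inner_sub_right, inner_smul_right, hst, mul_zero, sub_zero] at h3
        · rw [refl_apply]
          exact sub_mem (Submodule.subset_span ⟨t', rfl, ht'⟩)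
            (Submodule.smul_mem _ _ (Submodule.subset_span ⟨t, rfl, hst⟩))
  have htop := (eq_bot_or_eq_top_of_refl_mem hgen hirred (LinearMap.ker T) fun t x hx => by
    rw [refl_apply]
    exact sub_mem hx (Submodule.smul_mem _ _ (h2 t))).resolve_left fun hbot => by
      obtain ⟨s⟩ := hne
      exact root_ne_zero s ((Submodule.mem_bot ℝ).1 (hbot ▸ h2 s))
  exact LinearMap.ker_eq_top.1 htop

end Roots

/-! ### Positive definiteness at positive parameters with $h_c=1$ -/

section Positivity

variable {ℓ : ℕ} (b : OrthonormalBasis (Fin ℓ) ℝ E) {W : Subgroup (E ≃ₗᵢ[ℝ] E)} [Finite W]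

theorem dirDeriv_add (y z : E) (f : MvPolynomial (Fin ℓ) ℝ) :
    dirDeriv b (y + z) f = dirDeriv b y f + dirDeriv b z f := by
  simp [dirDeriv_apply, inner_add_right, add_smul, Finset.sum_add_distrib]

theorem dirDeriv_comm (y z : E) (f : MvPolynomial (Fin ℓ) ℝ) :
    dirDeriv b y (dirDeriv b z f) = dirDeriv b z (dirDeriv b y f) := by
  have h := dunkl_comm b (0 : ReflClass (⊥ : Subgroup (E ≃ₗᵢ[ℝ] E)) → ℝ) y z f
  rwa [dunkl_zero_param, dunkl_zero_param, dunkl_zero_param, dunkl_zero_param] at h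

/-- The Hessian of a polynomial, as a bilinear map. -/
def hessian (f : MvPolynomial (Fin ℓ) ℝ) : E →ₗ[ℝ] E →ₗ[ℝ] MvPolynomial (Fin ℓ) ℝ :=
  LinearMap.mk₂ ℝ (fun x y => dirDeriv b x (dirDeriv b y f))
    (fun x x' y => dirDeriv_add b x x' _) (fun r x y => dirDeriv_smul b r x _)
    (fun x y y' => by simp only [dirDeriv_add, map_add])
    (fun r x y => by
      simp only [dirDeriv_smul, Algebra.algebraMap_self, RingHom.id_apply, Derivation.map_smul])

/-- Euler's identity is applied twice, which needs degree at least two. -/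
theorem eq_zero_of_hessian_eq_zero {f : MvPolynomial (Fin ℓ) ℝ} {n : ℕ}
    (hf : f.IsHomogeneous (n + 2)) (h : hessian b f = 0) : f = 0 := by
  have h2 : ∀ i j, pderiv i (pderiv j f) = 0 := by
    intro i j
    have := LinearMap.congr_fun₂ h (b i) (b j)
    rwa [hessian, LinearMap.mk₂_apply, dirDeriv_basis, dirDeriv_basis] at this
  have h1 : ∀ j, pderiv j f = 0 := by
    intro j
    have hj : (pderiv j f).IsHomogeneous (n + 1) := by
      rw [← dirDeriv_basis b]
      exact hf.dirDeriv b (b j)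
    have := hj.sum_X_mul_pderiv
    simp only [h2, mul_zero, Finset.sum_const_zero] at this
    exact (smul_eq_zero.1 this.symm).resolve_left (Nat.succ_ne_zero n)
  have := hf.sum_X_mul_pderiv
  simp only [h1, mul_zero, Finset.sum_const_zero] at this
  exact (smul_eq_zero.1 this.symm).resolve_left (Nat.succ_ne_zero _)

/-- A vanishing sum of nonnegative terms with positive weights makes all second derivatives along
the roots vanish, so the Hessian is zero. -/
theorem form_zero_euler_pos
    (hgen : Subgroup.closure {s | s ∈ W ∧ IsReflection s} = W)
    (hirred : ∀ U : Submodule ℝ E, (∀ w ∈ W, ∀ x ∈ U, w x ∈ U) → U = ⊥ ∨ U = ⊤)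
    (hne : Nonempty (Refl W)) (c : ReflClass W → ℝ) (hc0 : ∀ o, 0 < c o) (hc1 : hc ℓ c = 1)
    {f : MvPolynomial (Fin ℓ) ℝ} {n : ℕ} (hf : f.IsHomogeneous (n + 2)) (hf0 : f ≠ 0) :
    0 < form b (0 : ReflClass W → ℝ) (euler b c f) f := by
  have hterm : ∀ s : Refl W,
      0 ≤ c ⟦s⟧ * form b (0 : ReflClass W → ℝ) (reflEuler b s f) f := fun s =>
    mul_nonneg (hc0 _).le (form_zero_reflEuler b s f).1
  rw [euler_eq_sum_reflEuler b hirred c hc1, map_sum, LinearMap.sum_apply]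
  simp only [map_smul, LinearMap.smul_apply, smul_eq_mul]
  refine (Finset.sum_nonneg fun s _ => hterm s).lt_of_ne' fun h => hf0 ?_
  rw [Finset.sum_eq_zero_iff_of_nonneg fun s _ => hterm s] at h
  refine eq_zero_of_hessian_eq_zero b hf
    (bilin_eq_zero_of_root_self hgen hirred hne _ (fun x y => dirDeriv_comm b x y f) fun s => ?_)
  have h0 : hessian b f (unitRoot s) (unitRoot s) = 0 :=
    (form_zero_reflEuler b s f).2 ((mul_eq_zero.1 (h s (Finset.mem_univ s))).resolve_left
      (hc0 _).ne')
  have hinv := inv_ne_zero (norm_ne_zero_iff.2 (root_ne_zero s))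
  rw [unitRoot, map_smul, map_smul, LinearMap.smul_apply] at h0
  exact (smul_eq_zero.1 ((smul_eq_zero.1 h0).resolve_left hinv)).resolve_left hinv

theorem exists_eq_lin {f : MvPolynomial (Fin ℓ) ℝ} (hf : f.IsHomogeneous 1) :
    ∃ v : E, f = lin b ℝ v := by
  rw [← mem_homogeneousSubmodule, homogeneousSubmodule_one_eq_span_X] at hf
  induction hf using Submodule.span_induction with
  | mem x hx =>
    obtain ⟨i, rfl⟩ := hx
    exact ⟨b i, (lin_basis b ℝ i).symm⟩
  | zero => exact ⟨0, (lin_zero b ℝ).symm⟩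
  | add x y _ _ hx hy =>
    obtain ⟨v, rfl⟩ := hx
    obtain ⟨w, rfl⟩ := hy
    exact ⟨v + w, (lin_add b ℝ v w).symm⟩
  | smul r x _ hx =>
    obtain ⟨v, rfl⟩ := hx
    refine ⟨r • v, ?_⟩
    rw [lin_smul, smul_eq_C_mul]
    rfl

/-- The induction on the degree: lowering by Dunkl operators gives positivity of $\Phi(Bf,f)$, and
the comparison with the Fischer form removes $B$. -/
theorem phi_pos_of_isHomogeneous
    (hgen : Subgroup.closure {s | s ∈ W ∧ IsReflection s} = W)
    (hirred : ∀ U : Submodule ℝ E, (∀ w ∈ W, ∀ x ∈ U, w x ∈ U) → U = ⊥ ∨ U = ⊤)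
    (hne : Nonempty (Refl W)) (c : ReflClass W → ℝ) (hc0 : ∀ o, 0 < c o) (hc1 : hc ℓ c = 1)
    (n : ℕ) : ∀ f : MvPolynomial (Fin ℓ) ℝ, f.IsHomogeneous (n + 1) → f ≠ 0 →
      0 < phi b c f f := by
  induction n with
  | zero =>
    intro f hf hf0
    obtain ⟨v, rfl⟩ := exists_eq_lin b hf
    have hv : v ≠ 0 := by
      rintro rfl
      exact hf0 (lin_zero b ℝ)
    have h := phi_lin_mul b hirred c v 1 (lin b ℝ v)
    rw [mul_one, phi_one, LinearMap.zero_apply, add_zero, map_one, one_mul, dirDeriv_lin,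
      constantCoeff_C, Algebra.algebraMap_self, RingHom.id_apply] at h
    rw [h]
    exact real_inner_self_pos.2 hv
  | succ n ih =>
    intro f hf hf0
    let U := homogeneousSubmodule (Fin ℓ) ℝ (n + 2)
    have : FiniteDimensional ℝ U := .of_fg (homogeneousSubmodule_fg _ _ _)
    let B : U →ₗ[ℝ] U := (euler b c).restrict fun g hg => IsHomogeneous.euler b c hg
    have hB : ∀ g : U, ((B g : U) : MvPolynomial (Fin ℓ) ℝ) = euler b c g := fun _ => rfl
    have hBp : ∀ g : U, g ≠ 0 → 0 < form b (0 : ReflClass W → ℝ) (B g) g := fun g hg =>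
      form_zero_euler_pos b hgen hirred hne c hc0 hc1 g.2 (by simpa using hg)
    refine pos_of_symmetric_pair (U := U) ((form b (0 : ReflClass W → ℝ)).domRestrict₁₂ U U)
      ((phi b c).domRestrict₁₂ U U) B (fun x y => form_zero_symm b _ _)
      (fun x hx => form_zero_pos b (by simpa using hx))
      (fun x y => bilin_euler_comm b _ (form_act_refl b _) c x.2 y.2) hBp
      (fun x y => bilin_euler_comm b _ (phi_act_refl b hirred c) c x.2 y.2)
      (fun x hx => ?_) ⟨f, hf⟩ (by simpa [Subtype.ext_iff] using hf0)
    have hx2 : (x : MvPolynomial (Fin ℓ) ℝ).IsHomogeneous (n + 2) := x.2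
    rw [LinearMap.domRestrict₁₂_apply, hB, phi_euler b hirred c hx2]
    have hnn : ∀ i, 0 ≤ phi b c (dunkl b c (b i) (x : MvPolynomial (Fin ℓ) ℝ))
        (dunkl b c (b i) (x : MvPolynomial (Fin ℓ) ℝ)) := by
      intro i
      rcases eq_or_ne (dunkl b c (b i) (x : MvPolynomial (Fin ℓ) ℝ)) 0 with h | h
      · rw [h, map_zero]
      · exact (ih _ (hx2.dunkl b c (b i)) h).le
    -- Strictness: if all $\nabla_{x_i}x$ vanished then $Bx=0$, against the positivity of `B` for
    -- the Fischer form.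
    refine (Finset.sum_nonneg fun i _ => hnn i).lt_of_ne' fun h => ?_
    rw [Finset.sum_eq_zero_iff_of_nonneg fun i _ => hnn i] at h
    have hD : ∀ i, dunkl b c (b i) (x : MvPolynomial (Fin ℓ) ℝ) = 0 := by
      intro i
      by_contra h0
      exact (ih _ (hx2.dunkl b c (b i)) h0).ne' (h i (Finset.mem_univ i))
    have h0 := hBp x hx
    rw [hB, euler_apply] at h0
    simp [hD] at h0

theorem phi_self_eq_sum
    (hirred : ∀ U : Submodule ℝ E, (∀ w ∈ W, ∀ x ∈ U, w x ∈ U) → U = ⊥ ∨ U = ⊤)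
    (c : ReflClass W → ℝ) (f : MvPolynomial (Fin ℓ) ℝ) :
    phi b c f f = ∑ i ∈ Finset.range (f.totalDegree + 1),
      phi b c (homogeneousComponent i f) (homogeneousComponent i f) := by
  conv_lhs => rw [← sum_homogeneousComponent f]
  rw [map_sum]
  refine Finset.sum_congr rfl fun i hi => ?_
  rw [map_sum, LinearMap.sum_apply]
  refine Finset.sum_eq_single i (fun j _ hj => ?_) (fun h => (h hi).elim)
  exact phi_eq_zero_of_isHomogeneous b hirred c hj (homogeneousComponent_isHomogeneous _ _)
    (homogeneousComponent_isHomogeneous _ _)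

theorem phi_pos
    (hgen : Subgroup.closure {s | s ∈ W ∧ IsReflection s} = W)
    (hirred : ∀ U : Submodule ℝ E, (∀ w ∈ W, ∀ x ∈ U, w x ∈ U) → U = ⊥ ∨ U = ⊤)
    (hne : Nonempty (Refl W)) (c : ReflClass W → ℝ) (hc0 : ∀ o, 0 < c o) (hc1 : hc ℓ c = 1)
    {f : MvPolynomial (Fin ℓ) ℝ} (hf : constantCoeff f = 0) (hf0 : f ≠ 0) :
    0 < phi b c f f := by
  have hz : homogeneousComponent 0 f = 0 := by
    rw [homogeneousComponent_zero, ← constantCoeff_eq, hf, C_0]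
  have hpos : ∀ i, homogeneousComponent i f ≠ 0 →
      0 < phi b c (homogeneousComponent i f) (homogeneousComponent i f) := by
    intro i hi
    cases i with
    | zero => exact (hi hz).elim
    | succ i =>
      exact phi_pos_of_isHomogeneous b hgen hirred hne c hc0 hc1 i _
        (homogeneousComponent_isHomogeneous _ _) hi
  obtain ⟨j, hj, hj0⟩ : ∃ j ∈ Finset.range (f.totalDegree + 1), homogeneousComponent j f ≠ 0 := by
    by_contra! h
    exact hf0 ((sum_homogeneousComponent f).symm.trans (Finset.sum_eq_zero h))
  rw [phi_self_eq_sum b hirred]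
  refine Finset.sum_pos' (fun i _ => ?_) ⟨j, hj, hpos j hj0⟩
  rcases eq_or_ne (homogeneousComponent i f) 0 with h | h
  · rw [h, map_zero]
  · exact (hpos i h).le

theorem phi_nonneg
    (hgen : Subgroup.closure {s | s ∈ W ∧ IsReflection s} = W)
    (hirred : ∀ U : Submodule ℝ E, (∀ w ∈ W, ∀ x ∈ U, w x ∈ U) → U = ⊥ ∨ U = ⊤)
    (hne : Nonempty (Refl W)) (c : ReflClass W → ℝ) (hc0 : ∀ o, 0 < c o) (hc1 : hc ℓ c = 1)
    {f : MvPolynomial (Fin ℓ) ℝ} (hf : constantCoeff f = 0) : 0 ≤ phi b c f f := by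
  rcases eq_or_ne f 0 with rfl | h
  · rw [map_zero]
  · exact (phi_pos b hgen hirred hne c hc0 hc1 hf h).le

theorem exists_eq_map_add_I_mul (w : MvPolynomial (Fin ℓ) ℂ) :
    ∃ f g : MvPolynomial (Fin ℓ) ℝ,
      w = map (algebraMap ℝ ℂ) f + C Complex.I * map (algebraMap ℝ ℂ) g := by
  induction w using MvPolynomial.induction_on' with
  | monomial a r =>
    refine ⟨monomial a r.re, monomial a r.im, ?_⟩
    rw [map_monomial, map_monomial, C_mul_monomial, ← map_add]
    congr 1
    rw [mul_comm]
    exact (Complex.re_add_im r).symm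
  | add p q hp hq =>
    obtain ⟨f, g, rfl⟩ := hp
    obtain ⟨f', g', rfl⟩ := hq
    refine ⟨f + f', g + g', ?_⟩
    simp only [map_add, mul_add]
    abel

/-- The hermitian form attached to `phi` is positive definite for a positive parameter with
`h_c = 1`. -/
theorem phi_conj_ne_zero
    (hgen : Subgroup.closure {s | s ∈ W ∧ IsReflection s} = W)
    (hirred : ∀ U : Submodule ℝ E, (∀ w ∈ W, ∀ x ∈ U, w x ∈ U) → U = ⊥ ∨ U = ⊤)
    (hne : Nonempty (Refl W)) (c : ReflClass W → ℝ) (hc0 : ∀ o, 0 < c o) (hc1 : hc ℓ c = 1)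
    {w : MvPolynomial (Fin ℓ) ℂ} (hw : constantCoeff w = 0) (hw0 : w ≠ 0) :
    phi b (fun o => algebraMap ℝ ℂ (c o)) w (map (starRingEnd ℂ) w) ≠ 0 := by
  obtain ⟨f, g, rfl⟩ := exists_eq_map_add_I_mul w
  have hconj : ∀ f : MvPolynomial (Fin ℓ) ℝ,
      map (starRingEnd ℂ) (map (algebraMap ℝ ℂ) f) = map (algebraMap ℝ ℂ) f := by
    intro f
    have h : (starRingEnd ℂ).comp (algebraMap ℝ ℂ) = algebraMap ℝ ℂ := by
      ext r
      simp
    rw [map_map, h]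
  have hcf : constantCoeff f = 0 ∧ constantCoeff g = 0 := by
    rw [map_add, map_mul, constantCoeff_C, constantCoeff_map, constantCoeff_map] at hw
    constructor
    · simpa using congrArg Complex.re hw
    · simpa using congrArg Complex.im hw
  have hφ : ∀ f g : MvPolynomial (Fin ℓ) ℝ, phi b (fun o => algebraMap ℝ ℂ (c o))
      (map (algebraMap ℝ ℂ) f) (map (algebraMap ℝ ℂ) g) = ((phi b c f g : ℝ) : ℂ) :=
    fun f g => phi_map b (Algebra.ofId ℝ ℂ) c f g
  -- Taking the real part discards the term $\Phi(g,f)-\Phi(f,g)$, so no symmetry of `phi` is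
  -- needed.
  have hval := congrArg Complex.re (show
    phi b (fun o => algebraMap ℝ ℂ (c o))
      (map (algebraMap ℝ ℂ) f + C Complex.I * map (algebraMap ℝ ℂ) g)
      (map (starRingEnd ℂ) (map (algebraMap ℝ ℂ) f + C Complex.I * map (algebraMap ℝ ℂ) g)) =
      ((phi b c f f + phi b c g g : ℝ) : ℂ) +
        Complex.I * ((phi b c g f - phi b c f g : ℝ) : ℂ) by
    rw [map_add (map _), map_mul (map _), map_C, hconj, hconj, Complex.conj_I,
      ← smul_eq_C_mul, ← smul_eq_C_mul, map_add, map_add, LinearMap.add_apply,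
      LinearMap.add_apply]
    simp only [map_smul, LinearMap.smul_apply, hφ, smul_eq_mul]
    push_cast
    linear_combination (-(phi b c g g : ℂ)) * Complex.I_mul_I)
  intro h
  rw [h] at hval
  simp only [Complex.zero_re, Complex.add_re, Complex.ofReal_re, Complex.mul_re, Complex.I_re,
    Complex.ofReal_im, mul_zero, zero_mul, sub_zero, add_zero] at hval
  have hf0 := phi_nonneg b hgen hirred hne c hc0 hc1 hcf.1
  have hg0 := phi_nonneg b hgen hirred hne c hc0 hc1 hcf.2
  have hf1 : f = 0 := by
    by_contra h0
    have := phi_pos b hgen hirred hne c hc0 hc1 hcf.1 h0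
    linarith
  have hg1 : g = 0 := by
    by_contra h0
    have := phi_pos b hgen hirred hne c hc0 hc1 hcf.2 h0
    linarith
  rw [hf1, hg1, map_zero, mul_zero, add_zero] at hw0
  exact hw0 rfl

end Positivity

/-! ### Detecting the ideal $(1-h_c)$ at positive real points -/

section Points

theorem _root_.MvPolynomial.IsHomogeneous.eval_mul {σ k : Type*} [CommRing k]
    {p : MvPolynomial σ k} {n : ℕ} (hp : p.IsHomogeneous n) (r : k) (x : σ → k) :
    eval (fun i => r * x i) p = r ^ n * eval x p := by
  rw [eval_eq, eval_eq, Finset.mul_sum]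
  refine Finset.sum_congr rfl fun d hd => ?_
  have hdeg : ∑ i ∈ d.support, d i = n := by
    by_contra h
    exact mem_support_iff.1 hd (hp.coeff_eq_zero h)
  simp only [mul_pow, Finset.prod_mul_distrib, Finset.prod_pow_eq_pow_sum, hdeg]
  ring

/-- A polynomial that vanishes at all positive points of the hyperplane `h = 1` is a multiple of
`1 - h`. -/
theorem exists_pos_eval_ne_zero {σ k : Type*} [Finite σ] [Field k] [Algebra ℝ k]
    (h : MvPolynomial σ k) (hpos : ∀ c : σ → ℝ, (∀ o, 0 < c o) →
      ∃ r : ℝ, 0 < r ∧ eval (fun o => algebraMap ℝ k (c o)) h = algebraMap ℝ k r)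
    (hh : h.IsHomogeneous 1)
    {p : MvPolynomial σ k} (hp : p ∉ Ideal.span {1 - h}) :
    ∃ c : σ → ℝ, (∀ o, 0 < c o) ∧ eval (fun o => algebraMap ℝ k (c o)) h = 1 ∧
      eval (fun o => algebraMap ℝ k (c o)) p ≠ 0 := by
  by_contra! hcon
  set D := p.totalDegree
  -- The homogenisation of `p` by powers of `h` vanishes on the whole positive orthant, by rescaling
  -- each point to the hyperplane; hence it is zero as a polynomial.
  have hP : ∑ i ∈ Finset.range (D + 1), h ^ (D - i) * homogeneousComponent i p = 0 := by
    refine funext_set (fun _ => algebraMap ℝ k '' Set.Ioi 0)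
      (fun _ => (Set.Ioi_infinite 0).image (algebraMap ℝ k).injective.injOn) fun x hx => ?_
    choose c hc0 hcx using fun o => hx o (Set.mem_univ o)
    have hx' : x = fun o => algebraMap ℝ k (c o) := funext fun o => (hcx o).symm
    obtain ⟨r, hr, hr'⟩ := hpos c hc0
    have hrk : algebraMap ℝ k r ≠ 0 := by
      simpa using hr.ne'
    let c' := fun o => c o / r
    have hxc' : x = fun o => algebraMap ℝ k r * algebraMap ℝ k (c' o) := by
      rw [hx']
      funext o
      rw [← map_mul, mul_div_cancel₀ _ hr.ne']
    have hh1 : eval (fun o => algebraMap ℝ k (c' o)) h = 1 := by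
      have := hh.eval_mul (algebraMap ℝ k r) (fun o => algebraMap ℝ k (c' o))
      rw [← hxc', hx', hr', pow_one] at this
      exact (mul_left_cancel₀ hrk (by rw [mul_one, ← this])).symm
    have h0 := hcon c' (fun o => div_pos (hc0 o) hr) hh1
    rw [map_zero, map_sum]
    calc ∑ i ∈ Finset.range (D + 1), eval x (h ^ (D - i) * homogeneousComponent i p)
        = ∑ i ∈ Finset.range (D + 1), algebraMap ℝ k r ^ D *
            eval (fun o => algebraMap ℝ k (c' o)) (homogeneousComponent i p) := by
          refine Finset.sum_congr rfl fun i hi => ?_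
          have hiD : i ≤ D := Nat.lt_succ_iff.1 (Finset.mem_range.1 hi)
          rw [map_mul, map_pow, hxc', hh.eval_mul, hh1,
            (homogeneousComponent_isHomogeneous i p).eval_mul, pow_one, mul_one, ← mul_assoc,
            ← pow_add, Nat.sub_add_cancel hiD]
      _ = 0 := by
          rw [← Finset.mul_sum, ← map_sum, sum_homogeneousComponent, h0, mul_zero]
  apply hp
  -- Subtracting the zero homogenisation writes `p` with coefficients $1-h^m$, all divisible by
  -- $1-h$.
  have hsplit : p = ∑ i ∈ Finset.range (D + 1),
      (1 - h ^ (D - i)) * homogeneousComponent i p := by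
    simp only [sub_mul, one_mul, Finset.sum_sub_distrib, hP, sub_zero]
    exact (sum_homogeneousComponent p).symm
  rw [hsplit]
  refine Ideal.sum_mem _ fun i _ => Ideal.mul_mem_right _ _ (Ideal.mem_span_singleton.2 ?_)
  simpa using sub_dvd_pow_sub_pow 1 h (D - i)

variable {ℓ : ℕ} {W : Subgroup (E ≃ₗᵢ[ℝ] E)} [Finite W]

theorem map_hc {R R' : Type*} [CommRing R] [Algebra ℝ R] [CommRing R'] [Algebra ℝ R']
    (φ : R →ₐ[ℝ] R') (c : ReflClass W → R) : φ (hc ℓ c) = hc ℓ fun o => φ (c o) := by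
  simp [hc]

variable (k : Type*) [Field k] [Algebra ℝ k]

theorem eval_hc_X (c : ReflClass W → ℝ) :
    eval (fun o => algebraMap ℝ k (c o)) (hc ℓ (X : ReflClass W → ParamRing k W)) =
      algebraMap ℝ k (hc ℓ c) := by
  have h1 := map_hc (ℓ := ℓ) ((aeval (R := k) (fun o => algebraMap ℝ k (c o))).restrictScalars ℝ)
    (X : ReflClass W → ParamRing k W)
  have h2 := map_hc (ℓ := ℓ) (Algebra.ofId ℝ k) c
  simp only [AlgHom.restrictScalars_apply, aeval_X] at h1
  rw [Algebra.ofId_apply] at h2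
  rw [h2]
  exact h1

theorem isHomogeneous_hc_X :
    (hc ℓ (X : ReflClass W → ParamRing k W)).IsHomogeneous 1 := by
  rw [hc, MvPolynomial.algebraMap_apply]
  exact (IsHomogeneous.sum _ _ _ fun s _ => isHomogeneous_X _ _).C_mul _

theorem exists_param_eval_ne_zero (hℓ : ℓ ≠ 0) (hne : Nonempty (Refl W)) {p : ParamRing k W}
    (hp : p ∉ hcIdeal k ℓ W) :
    ∃ c : ReflClass W → ℝ, (∀ o, 0 < c o) ∧ hc ℓ c = 1 ∧
      eval (fun o => algebraMap ℝ k (c o)) p ≠ 0 := by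
  have hpos : ∀ c : ReflClass W → ℝ, (∀ o, 0 < c o) → 0 < hc ℓ c := by
    intro c hc0
    have : (0 : ℝ) < 2 / ℓ := div_pos two_pos (Nat.cast_pos.2 (Nat.pos_of_ne_zero hℓ))
    exact mul_pos this (Finset.sum_pos (fun s _ => hc0 _) Finset.univ_nonempty)
  obtain ⟨c, h0, h1, h2⟩ := exists_pos_eval_ne_zero
    (hc ℓ (X : ReflClass W → ParamRing k W)) (fun c hc0 => ⟨hc ℓ c, hpos c hc0, eval_hc_X k c⟩)
    (isHomogeneous_hc_X k) hp
  refine ⟨c, h0, (algebraMap ℝ k).injective ?_, h2⟩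
  rw [map_one, ← h1, eval_hc_X]

theorem eval_eq_zero_of_mem_hcIdeal {c : ReflClass W → ℝ} (hc1 : hc ℓ c = 1)
    {p : ParamRing k W} (hp : p ∈ hcIdeal k ℓ W) :
    eval (fun o => algebraMap ℝ k (c o)) p = 0 := by
  obtain ⟨q, rfl⟩ := Ideal.mem_span_singleton.1 hp
  rw [map_mul, map_sub, eval_hc_X, hc1, map_one, map_one, sub_self, zero_mul]

/-- A real polynomial outside its ideal is nonzero at a real point of the hyperplane, while the
complex ideal vanishes there. -/
theorem quotComplexify_injective (hℓ : ℓ ≠ 0) (hne : Nonempty (Refl W)) :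
    Function.Injective (quotComplexify ℓ W) := by
  rw [injective_iff_map_eq_zero]
  intro q hq
  obtain ⟨p, rfl⟩ := Ideal.Quotient.mk_surjective q
  rw [quotComplexify, Ideal.quotientMap_mk, Ideal.Quotient.eq_zero_iff_mem] at hq
  rw [Ideal.Quotient.eq_zero_iff_mem]
  by_contra hp
  obtain ⟨c, _, hc1, hcp⟩ := exists_param_eval_ne_zero ℝ hℓ hne hp
  have h := eval_eq_zero_of_mem_hcIdeal ℂ hc1 hq
  have h' := aeval_algebraMap_apply ℂ c p
  rw [aeval_def] at h'
  rw [eval_map] at h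
  exact hcp ((map_eq_zero _).1 (h'.symm.trans h))

end Points

/-! ### Lifting polynomials without constant term -/

section SPlus

variable {ℓ : ℕ}

theorem mem_SPlus {R : Type*} [CommRing R] {f : MvPolynomial (Fin ℓ) R} :
    f ∈ SPlus ℓ R ↔ constantCoeff f = 0 := Iff.rfl

theorem SPlus.coe_map {R R' : Type*} [CommRing R] [CommRing R'] (φ : R →+* R') (f : SPlus ℓ R) :
    (SPlus.map φ f : MvPolynomial (Fin ℓ) R') = MvPolynomial.map φ f := rfl

theorem SPlus.map_surjective {R R' : Type*} [CommRing R] [CommRing R'] {φ : R →+* R'}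
    (hφ : Function.Surjective φ) : Function.Surjective (SPlus.map (ℓ := ℓ) φ) := by
  intro u
  obtain ⟨g, hg⟩ := MvPolynomial.map_surjective φ hφ (u : MvPolynomial (Fin ℓ) R')
  have hu : φ (constantCoeff g) = 0 := by
    rw [← constantCoeff_map, hg]
    exact u.2
  refine ⟨⟨g - C (constantCoeff g), ?_⟩, ?_⟩
  · rw [mem_SPlus, map_sub, constantCoeff_C, sub_self]
  · ext1
    rw [SPlus.coe_map, map_sub, map_C, hu, map_zero, sub_zero, hg]

end SPlus

/-! ### Reduction modulo $1-h_c$ and complex conjugation -/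

section Reduction

variable {ℓ : ℕ} {W : Subgroup (E ≃ₗᵢ[ℝ] E)}

theorem nonempty_refl
    (hgen : Subgroup.closure {s | s ∈ W ∧ IsReflection s} = W) (hnontriv : W ≠ ⊥) :
    Nonempty (Refl W) := by
  by_contra hne
  apply hnontriv
  rw [← hgen, Subgroup.closure_eq_bot_iff]
  intro s hs
  exact (hne ⟨⟨⟨s, hs.1⟩, hs.2⟩⟩).elim

theorem dim_ne_zero_of_refl (b : OrthonormalBasis (Fin ℓ) ℝ E) (s : Refl W) : ℓ ≠ 0 := by
  rintro rfl
  have : Subsingleton E := b.toBasis.repr.toEquiv.subsingleton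
  exact root_ne_zero s (Subsingleton.elim _ _)

/-- Complex conjugation of the coefficients of a polynomial in the parameters. -/
def conjParam : ParamRing ℂ W →+* ParamRing ℂ W := map (starRingEnd ℂ)

theorem conjParam_conjParam (p : ParamRing ℂ W) : conjParam (conjParam p) = p := by
  have h : (starRingEnd ℂ).comp (starRingEnd ℂ) = RingHom.id ℂ := by
    ext r
    simp
  rw [conjParam, map_map, h, map_id]

theorem conjParam_algebraMap (r : ℝ) :
    conjParam (algebraMap ℝ (ParamRing ℂ W) r) = algebraMap ℝ (ParamRing ℂ W) r := by
  rw [conjParam, MvPolynomial.algebraMap_apply, map_C]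
  simp

theorem conjParam_map (p : ParamRing ℝ W) :
    conjParam (map (algebraMap ℝ ℂ) p) = map (algebraMap ℝ ℂ) p := by
  have h : (starRingEnd ℂ).comp (algebraMap ℝ ℂ) = algebraMap ℝ ℂ := by
    ext r
    simp
  rw [conjParam, map_map, h]

theorem eval_conjParam (c : ReflClass W → ℝ) (p : ParamRing ℂ W) :
    eval (fun o => algebraMap ℝ ℂ (c o)) (conjParam p) =
      starRingEnd ℂ (eval (fun o => algebraMap ℝ ℂ (c o)) p) := by
  induction p using MvPolynomial.induction_on with
  | C a => simp [conjParam]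
  | add p q hp hq => rw [map_add, map_add, map_add, map_add, hp, hq]
  | mul_X p i hp =>
    rw [map_mul, map_mul, map_mul, map_mul, hp]
    simp [conjParam]

theorem map_conjParam_map_conjParam (f : MvPolynomial (Fin ℓ) (ParamRing ℂ W)) :
    map conjParam (map conjParam f) = f := by
  have h : (conjParam (W := W)).comp conjParam = RingHom.id _ := RingHom.ext conjParam_conjParam
  rw [map_map, h, map_id]

variable (b : OrthonormalBasis (Fin ℓ) ℝ E) [Finite W]

/-- The constant terms vanish in `form_eq_phi`, and $1-h_c$ is invertible in the fraction field. -/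
theorem algebraMap_phi_eq_Phi
    (hirred : ∀ U : Submodule ℝ E, (∀ w ∈ W, ∀ x ∈ U, w x ∈ U) → U = ⊥ ∨ U = ⊤)
    (f g : SPlus ℓ (ParamRing ℂ W)) :
    algebraMap (ParamRing ℂ W) (FractionRing (ParamRing ℂ W))
      (phi b (X : ReflClass W → ParamRing ℂ W) f g) = Phi b W f g := by
  have hinj := FaithfulSMul.algebraMap_injective (ParamRing ℂ W) (FractionRing (ParamRing ℂ W))
  have h0 : algebraMap (ParamRing ℂ W) (FractionRing (ParamRing ℂ W))
      (1 - hc ℓ (X : ReflClass W → ParamRing ℂ W)) ≠ 0 := by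
    rw [ne_eq, map_eq_zero_iff _ hinj]
    exact one_sub_hc_X_ne_zero
  have hform := form_map b (IsScalarTower.toAlgHom ℝ (ParamRing ℂ W)
    (FractionRing (ParamRing ℂ W))) (X : ReflClass W → ParamRing ℂ W) f g
  have hf : constantCoeff (f : MvPolynomial (Fin ℓ) (ParamRing ℂ W)) = 0 := f.2
  have hphi := form_eq_phi b hirred (X : ReflClass W → ParamRing ℂ W) f g
  rw [hf, zero_mul, zero_add, mul_comm] at hphi
  rw [hphi] at hform
  rw [Phi, eq_div_iff h0, ← map_mul]
  exact hform.symm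

theorem eq_one_sub_hc_mul_of_map_mk_eq_zero {f : MvPolynomial (Fin ℓ) (ParamRing ℂ W)}
    (hf : map (Ideal.Quotient.mk (hcIdeal ℂ ℓ W)) f = 0) :
    ∃ f', f = (1 - hc ℓ (X : ReflClass W → ParamRing ℂ W)) • f' := by
  have h : C (1 - hc ℓ (X : ReflClass W → ParamRing ℂ W)) ∣ f := by
    rw [C_dvd_iff_dvd_coeff]
    intro a
    have := congrArg (coeff a) hf
    rwa [coeff_map, coeff_zero, Ideal.Quotient.eq_zero_iff_mem, hcIdeal,
      Ideal.mem_span_singleton] at this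
  obtain ⟨f', hf'⟩ := h
  exact ⟨f', by rw [hf', smul_eq_C_mul]⟩

theorem mk_one_sub_hc :
    Ideal.Quotient.mk (hcIdeal ℂ ℓ W) (1 - hc ℓ (X : ReflClass W → ParamRing ℂ W)) = 0 :=
  Ideal.Quotient.eq_zero_iff_mem.2 (Ideal.mem_span_singleton_self _)

/-- Changing either lift adds a multiple of $1-h_c$ to the value by bilinearity; this makes the
reduced form independent of the lifts. -/
theorem mk_phi_congr {f f' g g' : MvPolynomial (Fin ℓ) (ParamRing ℂ W)}
    (hf : map (Ideal.Quotient.mk (hcIdeal ℂ ℓ W)) f = map (Ideal.Quotient.mk (hcIdeal ℂ ℓ W)) f')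
    (hg : map (Ideal.Quotient.mk (hcIdeal ℂ ℓ W)) g =
      map (Ideal.Quotient.mk (hcIdeal ℂ ℓ W)) g') :
    Ideal.Quotient.mk (hcIdeal ℂ ℓ W) (phi b X f g) =
      Ideal.Quotient.mk (hcIdeal ℂ ℓ W) (phi b X f' g') := by
  obtain ⟨p, hp⟩ := eq_one_sub_hc_mul_of_map_mk_eq_zero (f := f - f')
    (by rw [map_sub, hf, sub_self])
  obtain ⟨q, hq⟩ := eq_one_sub_hc_mul_of_map_mk_eq_zero (f := g - g')
    (by rw [map_sub, hg, sub_self])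
  rw [sub_eq_iff_eq_add] at hp hq
  have h1 : phi b X f g =
      (1 - hc ℓ (X : ReflClass W → ParamRing ℂ W)) * phi b X p g + phi b X f' g := by
    rw [hp, map_add (phi b X), map_smul, LinearMap.add_apply, LinearMap.smul_apply, smul_eq_mul]
  have h2 : phi b X f' g =
      (1 - hc ℓ (X : ReflClass W → ParamRing ℂ W)) * phi b X f' q + phi b X f' g' := by
    rw [hq, map_add, map_smul, smul_eq_mul]
  rw [h1, h2, map_add, map_add, map_mul, map_mul, mk_one_sub_hc, zero_mul, zero_mul, zero_add,
    zero_add]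

/-- A representative in `ℂ[c] ⊗ S(V)_+` of a polynomial over `ℂ[c]/(1 - h_c)`. -/
def liftSPlus (u : SPlus ℓ (QuotRing ℂ ℓ W)) : MvPolynomial (Fin ℓ) (ParamRing ℂ W) :=
  (SPlus.map_surjective Ideal.Quotient.mk_surjective u).choose

theorem map_liftSPlus (u : SPlus ℓ (QuotRing ℂ ℓ W)) :
    map (Ideal.Quotient.mk (hcIdeal ℂ ℓ W)) (liftSPlus u) = u :=
  congrArg Subtype.val (SPlus.map_surjective Ideal.Quotient.mk_surjective u).choose_spec

theorem mk_phi_liftSPlus {u v : SPlus ℓ (QuotRing ℂ ℓ W)}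
    {f g : MvPolynomial (Fin ℓ) (ParamRing ℂ W)}
    (hf : map (Ideal.Quotient.mk (hcIdeal ℂ ℓ W)) f = u)
    (hg : map (Ideal.Quotient.mk (hcIdeal ℂ ℓ W)) g = v) :
    Ideal.Quotient.mk (hcIdeal ℂ ℓ W) (phi b X (liftSPlus u) (liftSPlus v)) =
      Ideal.Quotient.mk (hcIdeal ℂ ℓ W) (phi b X f g) :=
  mk_phi_congr b ((map_liftSPlus u).trans hf.symm) ((map_liftSPlus v).trans hg.symm)

/-- The reduction of `phi` modulo `1 - h_c`. -/
def phiBar : LinearMap.BilinForm (QuotRing ℂ ℓ W) (SPlus ℓ (QuotRing ℂ ℓ W)) :=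
  LinearMap.mk₂ (QuotRing ℂ ℓ W)
    (fun u v => Ideal.Quotient.mk (hcIdeal ℂ ℓ W) (phi b X (liftSPlus u) (liftSPlus v)))
    (fun u u' v => by
      rw [mk_phi_liftSPlus b (f := liftSPlus u + liftSPlus u') (g := liftSPlus v)
        (by rw [map_add, map_liftSPlus, map_liftSPlus, Submodule.coe_add]) (map_liftSPlus v),
        map_add (phi b X), LinearMap.add_apply, map_add])
    (fun q u v => by
      obtain ⟨r, rfl⟩ := Ideal.Quotient.mk_surjective q
      rw [mk_phi_liftSPlus b (f := C r * liftSPlus u) (g := liftSPlus v)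
        (by rw [map_mul, map_C, map_liftSPlus, Submodule.coe_smul, smul_eq_C_mul])
        (map_liftSPlus v), ← smul_eq_C_mul, map_smul, LinearMap.smul_apply, smul_eq_mul, map_mul,
        smul_eq_mul])
    (fun u v v' => by
      rw [mk_phi_liftSPlus b (f := liftSPlus u) (g := liftSPlus v + liftSPlus v')
        (map_liftSPlus u) (by rw [map_add, map_liftSPlus, map_liftSPlus, Submodule.coe_add]),
        map_add, map_add])
    (fun q u v => by
      obtain ⟨r, rfl⟩ := Ideal.Quotient.mk_surjective q
      rw [mk_phi_liftSPlus b (f := liftSPlus u) (g := C r * liftSPlus v) (map_liftSPlus u)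
        (by rw [map_mul, map_C, map_liftSPlus, Submodule.coe_smul, smul_eq_C_mul]),
        ← smul_eq_C_mul, map_smul, smul_eq_mul, map_mul, smul_eq_mul])

theorem isReductionOfPhi_iff
    (hirred : ∀ U : Submodule ℝ E, (∀ w ∈ W, ∀ x ∈ U, w x ∈ U) → U = ⊥ ∨ U = ⊤)
    (Ψ : LinearMap.BilinForm (QuotRing ℂ ℓ W) (SPlus ℓ (QuotRing ℂ ℓ W))) :
    IsReductionOfPhi b W Ψ ↔ ∀ f g : SPlus ℓ (ParamRing ℂ W),
      Ψ (SPlus.map (Ideal.Quotient.mk (hcIdeal ℂ ℓ W)) f)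
        (SPlus.map (Ideal.Quotient.mk (hcIdeal ℂ ℓ W)) g) =
      Ideal.Quotient.mk (hcIdeal ℂ ℓ W) (phi b X f g) := by
  refine ⟨fun h f g => h f g _ (algebraMap_phi_eq_Phi b hirred f g), fun h f g p hp => ?_⟩
  rw [h]
  rw [← algebraMap_phi_eq_Phi b hirred] at hp
  rw [FaithfulSMul.algebraMap_injective (ParamRing ℂ W) (FractionRing (ParamRing ℂ W)) hp]

theorem existsUnique_isReductionOfPhi
    (hirred : ∀ U : Submodule ℝ E, (∀ w ∈ W, ∀ x ∈ U, w x ∈ U) → U = ⊥ ∨ U = ⊤) :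
    ∃! Ψ : LinearMap.BilinForm (QuotRing ℂ ℓ W) (SPlus ℓ (QuotRing ℂ ℓ W)),
      IsReductionOfPhi b W Ψ := by
  have hΨ : IsReductionOfPhi b W (phiBar b) :=
    (isReductionOfPhi_iff b hirred _).2 fun f g => mk_phi_liftSPlus b rfl rfl
  refine ⟨phiBar b, hΨ, fun Ψ h => ?_⟩
  change IsReductionOfPhi b W Ψ at h
  rw [isReductionOfPhi_iff b hirred] at h hΨ
  refine LinearMap.ext₂ fun u v => ?_
  obtain ⟨f, rfl⟩ := SPlus.map_surjective Ideal.Quotient.mk_surjective u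
  obtain ⟨g, rfl⟩ := SPlus.map_surjective Ideal.Quotient.mk_surjective v
  rw [h, hΨ]

/-- Some coefficient of `f` lies outside the ideal, so `f` stays nonzero at a suitable positive
point of the hyperplane. There conjugating coefficients agrees with conjugating values, and the
hermitian positivity applies. -/
theorem mk_phi_conj_ne_zero
    (hgen : Subgroup.closure {s | s ∈ W ∧ IsReflection s} = W)
    (hirred : ∀ U : Submodule ℝ E, (∀ w ∈ W, ∀ x ∈ U, w x ∈ U) → U = ⊥ ∨ U = ⊤)
    (hℓ : ℓ ≠ 0) (hne : Nonempty (Refl W)) {f : MvPolynomial (Fin ℓ) (ParamRing ℂ W)}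
    (hf : constantCoeff f = 0) (hf0 : map (Ideal.Quotient.mk (hcIdeal ℂ ℓ W)) f ≠ 0) :
    Ideal.Quotient.mk (hcIdeal ℂ ℓ W) (phi b X f (map conjParam f)) ≠ 0 := by
  obtain ⟨a, ha⟩ := ne_zero_iff.1 hf0
  rw [coeff_map, ne_eq, Ideal.Quotient.eq_zero_iff_mem] at ha
  obtain ⟨c, hc0, hc1, hca⟩ := exists_param_eval_ne_zero ℂ hℓ hne ha
  let φ : ParamRing ℂ W →ₐ[ℝ] ℂ := (aeval fun o => algebraMap ℝ ℂ (c o)).restrictScalars ℝ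
  have hφ : ∀ p, φ p = eval (fun o => algebraMap ℝ ℂ (c o)) p := fun p => rfl
  intro h
  rw [Ideal.Quotient.eq_zero_iff_mem] at h
  have h1 := eval_eq_zero_of_mem_hcIdeal ℂ hc1 h
  rw [← hφ, ← phi_map, map_map] at h1
  have hX : (fun o => φ ((X : ReflClass W → ParamRing ℂ W) o)) =
      fun o => algebraMap ℝ ℂ (c o) := by
    ext o
    exact aeval_X _ o
  have hcomp : (φ : ParamRing ℂ W →+* ℂ).comp conjParam =
      (starRingEnd ℂ).comp (φ : ParamRing ℂ W →+* ℂ) :=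
    RingHom.ext (eval_conjParam c)
  rw [hX, hcomp, ← map_map] at h1
  refine phi_conj_ne_zero b hgen hirred hne c hc0 hc1 ?_ (fun h0 => hca ?_) h1
  · rw [constantCoeff_map, hf, map_zero]
  · have := congrArg (coeff a) h0
    rwa [coeff_map, coeff_zero] at this

theorem conjParam_one_sub_hc :
    conjParam (1 - hc ℓ (X : ReflClass W → ParamRing ℂ W)) = 1 - hc ℓ X := by
  rw [map_sub, map_one, hc, map_mul, conjParam_algebraMap, map_sum]
  simp [conjParam]

theorem map_mk_map_conjParam_eq_zero {f : MvPolynomial (Fin ℓ) (ParamRing ℂ W)}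
    (hf : map (Ideal.Quotient.mk (hcIdeal ℂ ℓ W)) f = 0) :
    map (Ideal.Quotient.mk (hcIdeal ℂ ℓ W)) (map conjParam f) = 0 := by
  obtain ⟨f', rfl⟩ := eq_one_sub_hc_mul_of_map_mk_eq_zero hf
  rw [smul_eq_C_mul, map_mul, map_C, conjParam_one_sub_hc, map_mul, map_C, mk_one_sub_hc, C_0,
    zero_mul]

theorem mk_phi_conj_left_ne_zero
    (hgen : Subgroup.closure {s | s ∈ W ∧ IsReflection s} = W)
    (hirred : ∀ U : Submodule ℝ E, (∀ w ∈ W, ∀ x ∈ U, w x ∈ U) → U = ⊥ ∨ U = ⊤)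
    (hℓ : ℓ ≠ 0) (hne : Nonempty (Refl W)) {f : MvPolynomial (Fin ℓ) (ParamRing ℂ W)}
    (hf : constantCoeff f = 0) (hf0 : map (Ideal.Quotient.mk (hcIdeal ℂ ℓ W)) f ≠ 0) :
    Ideal.Quotient.mk (hcIdeal ℂ ℓ W) (phi b X (map conjParam f) f) ≠ 0 := by
  have h := mk_phi_conj_ne_zero b hgen hirred hℓ hne (f := map conjParam f)
    (by rw [constantCoeff_map, hf, map_zero])
    (fun h0 => hf0 (by simpa only [map_conjParam_map_conjParam] using
      map_mk_map_conjParam_eq_zero h0))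
  rwa [map_conjParam_map_conjParam] at h

/-- Stability of the extended space under conjugation, phrased with lifts so that no conjugation on
the quotient is required. It holds because the generators are real. -/
theorem exists_conj_mem_extendScalars (U : Submodule ℝ (SPlus ℓ ℝ))
    {v : SPlus ℓ (QuotRing ℂ ℓ W)} (hv : v ∈ extendScalars W U) :
    ∃ f : SPlus ℓ (ParamRing ℂ W), SPlus.map (Ideal.Quotient.mk (hcIdeal ℂ ℓ W)) f = v ∧
      SPlus.map (Ideal.Quotient.mk (hcIdeal ℂ ℓ W)) (SPlus.map conjParam f) ∈
        extendScalars W U := by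
  induction hv using Submodule.span_induction with
  | mem v hv =>
    obtain ⟨u, hu, rfl⟩ := hv
    have h1 : (Ideal.Quotient.mk (hcIdeal ℂ ℓ W)).comp (algebraMap ℝ (ParamRing ℂ W)) =
        algebraMap ℝ (QuotRing ℂ ℓ W) := rfl
    have h2 : conjParam.comp (algebraMap ℝ (ParamRing ℂ W)) = algebraMap ℝ (ParamRing ℂ W) :=
      RingHom.ext conjParam_algebraMap
    have h3 : ((Ideal.Quotient.mk (hcIdeal ℂ ℓ W)).comp conjParam).comp
        (algebraMap ℝ (ParamRing ℂ W)) = algebraMap ℝ (QuotRing ℂ ℓ W) := by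
      rw [RingHom.comp_assoc, h2, h1]
    refine ⟨SPlus.map (algebraMap ℝ (ParamRing ℂ W)) u, ?_, ?_⟩
    · ext1
      rw [SPlus.coe_map, SPlus.coe_map, map_map, h1, SPlus.coe_map]
    · refine Submodule.subset_span ⟨u, hu, ?_⟩
      ext1
      rw [SPlus.coe_map, SPlus.coe_map, SPlus.coe_map, SPlus.coe_map, map_map, map_map, h3]
  | zero =>
    refine ⟨0, by ext1; simp [SPlus.coe_map], ?_⟩
    convert Submodule.zero_mem _
    ext1
    simp [SPlus.coe_map]
  | add v w _ _ hv hw =>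
    obtain ⟨f, rfl, hf⟩ := hv
    obtain ⟨g, rfl, hg⟩ := hw
    refine ⟨f + g, by ext1; simp [SPlus.coe_map], ?_⟩
    convert Submodule.add_mem _ hf hg
    ext1
    simp [SPlus.coe_map]
  | smul q v _ hv =>
    obtain ⟨f, rfl, hf⟩ := hv
    obtain ⟨r, rfl⟩ := Ideal.Quotient.mk_surjective q
    refine ⟨r • f, by ext1; simp [SPlus.coe_map, smul_eq_C_mul], ?_⟩
    convert Submodule.smul_mem _ (Ideal.Quotient.mk (hcIdeal ℂ ℓ W) (conjParam r)) hf
    ext1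
    simp [SPlus.coe_map, smul_eq_C_mul]

theorem reduction_self_ne_zero
    (hgen : Subgroup.closure {s | s ∈ W ∧ IsReflection s} = W)
    (hirred : ∀ U : Submodule ℝ E, (∀ w ∈ W, ∀ x ∈ U, w x ∈ U) → U = ⊥ ∨ U = ⊤)
    (hℓ : ℓ ≠ 0) (hne : Nonempty (Refl W))
    {Ψ : LinearMap.BilinForm (QuotRing ℂ ℓ W) (SPlus ℓ (QuotRing ℂ ℓ W))}
    (hΨ : IsReductionOfPhi b W Ψ) {u : SPlus ℓ (QuotRing ℝ ℓ W)} (hu : u ≠ 0) :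
    Ψ (SPlus.map (quotComplexify ℓ W) u) (SPlus.map (quotComplexify ℓ W) u) ≠ 0 := by
  rw [isReductionOfPhi_iff b hirred] at hΨ
  obtain ⟨g, rfl⟩ := SPlus.map_surjective Ideal.Quotient.mk_surjective u
  let ι : ParamRing ℝ W →+* ParamRing ℂ W := map (algebraMap ℝ ℂ)
  have hι : (quotComplexify ℓ W).comp (Ideal.Quotient.mk (hcIdeal ℝ ℓ W)) =
      (Ideal.Quotient.mk (hcIdeal ℂ ℓ W)).comp ι := rfl
  have hmap : SPlus.map (quotComplexify ℓ W) (SPlus.map (Ideal.Quotient.mk (hcIdeal ℝ ℓ W)) g) =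
      SPlus.map (Ideal.Quotient.mk (hcIdeal ℂ ℓ W)) (SPlus.map ι g) := by
    ext1
    rw [SPlus.coe_map, SPlus.coe_map, map_map, hι, SPlus.coe_map, SPlus.coe_map, map_map]
  -- A real element has a lift fixed by conjugation, so the hermitian statement becomes one about
  -- $\overline\Phi_c(u,u)$.
  have hconj : map conjParam (SPlus.map ι g : MvPolynomial (Fin ℓ) (ParamRing ℂ W)) =
      SPlus.map ι g := by
    have : conjParam.comp ι = ι := RingHom.ext conjParam_map
    rw [SPlus.coe_map, map_map, this]
  have h := mk_phi_conj_ne_zero b hgen hirred hℓ hne (SPlus.map ι g).2 (fun h0 => hu ?_)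
  · rwa [hconj, ← hΨ, ← hmap] at h
  · have hinj := MvPolynomial.map_injective (σ := Fin ℓ) _ (quotComplexify_injective hℓ hne)
    ext1
    apply hinj
    rw [Submodule.coe_zero, map_zero, ← h0, ← SPlus.coe_map, ← SPlus.coe_map, hmap]

/-- A nonzero vector is tested against its own conjugate, which lies in the same space. Left and
right kernels are treated separately by placing the conjugate in the other slot. -/
theorem restrict_reduction_nondegenerate
    (hgen : Subgroup.closure {s | s ∈ W ∧ IsReflection s} = W)
    (hirred : ∀ U : Submodule ℝ E, (∀ w ∈ W, ∀ x ∈ U, w x ∈ U) → U = ⊥ ∨ U = ⊤)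
    (hℓ : ℓ ≠ 0) (hne : Nonempty (Refl W))
    {Ψ : LinearMap.BilinForm (QuotRing ℂ ℓ W) (SPlus ℓ (QuotRing ℂ ℓ W))}
    (hΨ : IsReductionOfPhi b W Ψ) (U : Submodule ℝ (SPlus ℓ ℝ)) :
    (Ψ.restrict (extendScalars W U)).Nondegenerate := by
  rw [isReductionOfPhi_iff b hirred] at hΨ
  constructor
  · intro v hv
    obtain ⟨f, hf, hmem⟩ := exists_conj_mem_extendScalars U v.2
    by_contra h0
    refine mk_phi_conj_ne_zero b hgen hirred hℓ hne f.2
      (fun h => h0 (Subtype.ext (hf.symm.trans (Subtype.ext h)))) ?_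
    have h := hv ⟨_, hmem⟩
    rw [LinearMap.BilinForm.restrict_apply, LinearMap.domRestrict_apply, ← hf, hΨ] at h
    exact h
  · intro v hv
    obtain ⟨f, hf, hmem⟩ := exists_conj_mem_extendScalars U v.2
    by_contra h0
    refine mk_phi_conj_left_ne_zero b hgen hirred hℓ hne f.2
      (fun h => h0 (Subtype.ext (hf.symm.trans (Subtype.ext h)))) ?_
    have h := hv ⟨_, hmem⟩
    rw [LinearMap.BilinForm.restrict_apply, LinearMap.domRestrict_apply, ← hf, hΨ] at h
    exact h

end Reduction

end Dunkl

end

/-! ### The main theorem -/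

theorem mainTheorem3 {E : Type*} [NormedAddCommGroup E] [InnerProductSpace ℝ E] {ℓ : ℕ}
    (b : OrthonormalBasis (Fin ℓ) ℝ E) (W : Subgroup (E ≃ₗᵢ[ℝ] E)) [Finite W]
    (hgen : Subgroup.closure {s | s ∈ W ∧ Dunkl.IsReflection s} = W)
    (hnontriv : W ≠ ⊥)
    (hirred : ∀ U : Submodule ℝ E, (∀ w ∈ W, ∀ x ∈ U, w x ∈ U) → U = ⊥ ∨ U = ⊤) :
    (∀ f g : Dunkl.SPlus ℓ (Dunkl.ParamRing ℂ W), ∃ p : Dunkl.ParamRing ℂ W,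
      algebraMap (Dunkl.ParamRing ℂ W) (FractionRing (Dunkl.ParamRing ℂ W)) p =
        Dunkl.Phi b W f g) ∧
    (∃! Ψ : LinearMap.BilinForm (Dunkl.QuotRing ℂ ℓ W) (Dunkl.SPlus ℓ (Dunkl.QuotRing ℂ ℓ W)),
      Dunkl.IsReductionOfPhi b W Ψ) ∧
    ∀ Ψ : LinearMap.BilinForm (Dunkl.QuotRing ℂ ℓ W) (Dunkl.SPlus ℓ (Dunkl.QuotRing ℂ ℓ W)),
      Dunkl.IsReductionOfPhi b W Ψ →
      (∀ u : Dunkl.SPlus ℓ (Dunkl.QuotRing ℝ ℓ W), u ≠ 0 →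
        Ψ (Dunkl.SPlus.map (Dunkl.quotComplexify ℓ W) u)
          (Dunkl.SPlus.map (Dunkl.quotComplexify ℓ W) u) ≠ 0) ∧
      ∀ U : Submodule ℝ (Dunkl.SPlus ℓ ℝ),
        (Ψ.restrict (Dunkl.extendScalars W U)).Nondegenerate := by
  have hne := Dunkl.nonempty_refl hgen hnontriv
  have hℓ := Dunkl.dim_ne_zero_of_refl b hne.some
  exact ⟨fun f g => ⟨_, Dunkl.algebraMap_phi_eq_Phi b hirred f g⟩,
    Dunkl.existsUnique_isReductionOfPhi b hirred, fun Ψ hΨ =>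
      ⟨fun u hu => Dunkl.reduction_self_ne_zero b hgen hirred hℓ hne hΨ hu,
        Dunkl.restrict_reduction_nondegenerate b hgen hirred hℓ hne hΨ⟩⟩
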